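/- Let $X$ be a set. Let $(X\cup X^{-1})^*$ be the free monoid with involution on $X$, let $\operatorname{red}(w)$ be the freely reduced form of a word $w$, and let $\operatorname{FIM}(X)$ be the free inverse monoid on $X$. An inverse monoid is $F$-inverse if every class of its least group congruence $\sigma$ has a greatest element for the natural partial order; $F$-inverse monoids form a variety in the signature $(\cdot,1,{}^{-1},{}^{\mathfrak m})$, where $s^{\mathfrak m}$ is the greatest element of the $\sigma$-class of $s$. For a relation $R$ on the set $\mathbb I\mathfrak m_X$ of formal terms $u_0v_1^{\mathfrak m}u_1\cdots v_n^{\mathfrak m}u_n$ ($u_i,v_i\in (X\cup X^{-1})^*$), $\operatorname{FInv}\langle X\mid R\rangle$ denotes the quotient of the free $F$-inverse monoid on $X$ by the congruence generated by $R$. Let $\Gamma_X$ be the Cayley graph of the free group $F(X)$ on $X$: its vertices are the elements of $F(X)$, and for each vertex $g$ and each $a\in X\cup X^{-1}$ there is an edge labelled $a$ from $g$ to $ga$, whose inverse edge is the one labelled $a^{-1}$ from $ga$ to $g$. A subgraph is a set of vertices and edges closed under taking endpoints and inverse edges; it is connected if any two of its vertices are joined by a path in it (so the empty subgraph is connected).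 A term $u_0v_1^{\mathfrak m}u_1\cdots v_n^{\mathfrak m}u_n$ labels a journey from $g$ to $h$ in a subgraph $\Delta$ if, starting at $g$, following alternately the paths labelled $u_i$ and the jumps from a vertex $k$ to the vertex $kv_i$, one stays in $\Delta$ and ends at $h$. Given a relation $R$ on $\mathbb I\mathfrak m_X$ whose related terms are equal in $F(X)$, a subgraph $\Delta$ is $c_R$-closed if for all $(p,q)\in R$ and all vertices $g,h$ of $\Delta$, $p$ labels a journey from $g$ to $h$ in $\Delta$ if and only if $q$ does; $\Delta^{c_R}$ is the least $c_R$-closed subgraph containing $\Delta$. Let $S_{c_R}$ be the set of pairs $(\Delta,g)$ where $g \in F(X)$ and $\Delta$ is the $c_R$-closure of a finite subgraph and contains the vertices $1$ and $g$, with the operations $(\Delta,g)(\Xi,h)=((\Delta\cup g\Xi)^{c_R},gh)$, $(\Delta,g)^{-1}=(g^{-1}\Delta,g^{-1})$, $(\Delta,g)^{\mathfrak m}=(\{1,g\}^{c_R},g)$ and identity $(\{1\}^{c_R},1)$. **Proposition.** Let $R$ be the set of relations $\operatorname{red}(w)=w^{\mathfrak m}$, $w\in (X\cup X^{-1})^*$,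 and let $S=\operatorname{FInv}\langle X\mid \operatorname{red}(w)=w^{\mathfrak m},\ w\in (X\cup X^{-1})^*\rangle$. 1. $\operatorname{FIM}(X)$ is $F$-inverse, with $(w_{\operatorname{FIM}(X)})^{\mathfrak m}=\operatorname{red}(w)_{\operatorname{FIM}(X)}$ for every $w\in (X\cup X^{-1})^*$, and there is an isomorphism of $F$-inverse monoids $S\cong\operatorname{FIM}(X)$ that respects the generators $X$; that is, $\operatorname{FIM}(X)$ is presented as an $F$-inverse monoid by $\operatorname{FInv}\langle X\mid \operatorname{red}(w)=w^{\mathfrak m},\ w\in (X\cup X^{-1})^*\rangle$. 2. The greatest group image $S/\sigma$ is the free group on $X$, by an isomorphism respecting the generators. 3. The $c_R$-closed subgraphs of $\Gamma_X$ are exactly the connected subgraphs. 4. $S_{c_R}$ is Munn's model: it consists exactly of the pairs $(\Delta,g)$ with $\Delta$ a finite connected subgraph of $\Gamma_X$ containing $1$ and $g$, and $(\Delta,g)(\Xi,h)=(\Delta\cup g\Xi,gh)$ in it. There is an isomorphism of inverse monoids $\operatorname{FIM}(X)\cong S_{c_R}$ mapping the element represented by each word $w$ to $(\langle\overline w\rangle,w_{F(X)})$,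 where $\langle\overline w\rangle$ is the subgraph spanned by the path labelled $w$ starting at $1$. There is also an isomorphism $S\cong S_{c_R}$ preserving all the operations, including ${}^{\mathfrak m}$, and mapping each generator $x \in X$ to $(\langle\overline x\rangle^{c_R},x)$. -/

import Mathlib

noncomputable section

universe u v

/-! ## Inverse monoids and F-inverse monoids -/

/-- Inverse monoids, as the variety of monoids with a unary operation in the signature
`(·, 1, ⁻¹)`.  See `InverseMonoid.eq_inv_iff`: `s⁻¹` is the unique inverse of `s`. -/
class InverseMonoid (M : Type*) extends Monoid M, InvolutiveInv M where
  mul_inv_rev' : ∀ a b : M, (a * b)⁻¹ = b⁻¹ * a⁻¹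
  mul_inv_mul' : ∀ a : M, a * a⁻¹ * a = a
  idem_comm' : ∀ a b : M, (a * a⁻¹) * (b * b⁻¹) = (b * b⁻¹) * (a * a⁻¹)

namespace InverseMonoid

variable {M : Type*} [InverseMonoid M]

theorem mul_inv_r (a b : M) : (a * b)⁻¹ = b⁻¹ * a⁻¹ := mul_inv_rev' a b

theorem mul_inv_mul (a : M) : a * (a⁻¹ * a) = a := by
  rw [← mul_assoc]; exact mul_inv_mul' a

theorem inv_mul_inv (a : M) : a⁻¹ * (a * a⁻¹) = a⁻¹ := by
  simpa using mul_inv_mul a⁻¹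

theorem comm_rr (a b : M) : (a * a⁻¹) * (b * b⁻¹) = (b * b⁻¹) * (a * a⁻¹) := idem_comm' a b

theorem inv_one' : (1 : M)⁻¹ = 1 := by
  simpa using mul_inv_mul (1 : M)

theorem idem_inv_eq {e : M} (he : e * e = e) : e⁻¹ = e := by
  have he' : e⁻¹ * e⁻¹ = e⁻¹ := by rw [← mul_inv_r, he]
  have hc := comm_rr e⁻¹ e
  rw [inv_inv] at hc
  calc e⁻¹ = e⁻¹ * e * (e * e⁻¹) := by
        rw [mul_assoc, ← mul_assoc e e, he, inv_mul_inv]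
    _ = e * e⁻¹ * (e⁻¹ * e) := hc
    _ = e := by rw [mul_assoc, ← mul_assoc e⁻¹ e⁻¹, he', mul_inv_mul]

theorem idem_mul_inv {e : M} (he : e * e = e) : e * e⁻¹ = e := by rw [idem_inv_eq he, he]

theorem idem_comm {e f : M} (he : e * e = e) (hf : f * f = f) : e * f = f * e := by
  have := comm_rr e f
  rwa [idem_mul_inv he, idem_mul_inv hf] at this

theorem rr_idem (a : M) : (a * a⁻¹) * (a * a⁻¹) = a * a⁻¹ := by
  rw [mul_assoc, inv_mul_inv]

theorem rr_inv (a : M) : (a * a⁻¹)⁻¹ = a * a⁻¹ := by rw [mul_inv_r, inv_inv]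

/-- `t` is an inverse of `s` in the semigroup sense iff `t = s⁻¹`. -/
theorem eq_inv_iff (s t : M) : (s * t * s = s ∧ t * s * t = t) ↔ t = s⁻¹ := by
  constructor
  · rintro ⟨h1, h2⟩
    have i1 : (s * t) * (s * t) = s * t := by rw [← mul_assoc, h1]
    have i2 : (t * s) * (t * s) = t * s := by rw [← mul_assoc, h2]
    have i3 := rr_idem s
    have i4 : (s⁻¹ * s) * (s⁻¹ * s) = s⁻¹ * s := by simpa using rr_idem s⁻¹
    have c1 := idem_comm i1 i3
    have c2 := idem_comm i2 i4
    calc t = t * s * t := h2.symm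
      _ = t * (s * s⁻¹ * (s * t)) := by
          rw [← mul_assoc (s * s⁻¹), mul_assoc s s⁻¹ s, mul_inv_mul, mul_assoc]
      _ = t * s * t * (s * s⁻¹) := by rw [← c1]; simp only [mul_assoc]
      _ = t * s * s⁻¹ := by rw [h2, mul_assoc]
      _ = t * s * (s⁻¹ * s) * s⁻¹ := by
          rw [mul_assoc (t * s), mul_assoc s⁻¹, inv_mul_inv]
      _ = s⁻¹ * s * t * s * s⁻¹ := by rw [c2]; simp only [mul_assoc]
      _ = s⁻¹ * (s * t * s) * s⁻¹ := by simp only [mul_assoc]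
      _ = s⁻¹ := by rw [h1, mul_assoc, inv_mul_inv]
  · rintro rfl
    exact ⟨mul_inv_mul' s, by rw [mul_assoc, inv_mul_inv]⟩

/-- The natural partial order: `a ≤ b` iff `a = a a⁻¹ b`. -/
def NatLE (a b : M) : Prop := a = a * a⁻¹ * b

/-- The relation `σ`: two elements are related iff they have a common lower bound in the natural
partial order. -/
def Sigma (a b : M) : Prop := ∃ c, NatLE c a ∧ NatLE c b

/-- `m` is the greatest element (for the natural partial order) of the `σ`-class of `s`. -/
def IsSigmaGreatest (s m : M) : Prop := Sigma s m ∧ ∀ t, Sigma s t → NatLE t m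

theorem NatLE.refl (a : M) : NatLE a a := (mul_inv_mul' a).symm

theorem idem_mul_le {e : M} (he : e * e = e) (a : M) : NatLE (e * a) a := by
  unfold NatLE
  have c := idem_comm he (rr_idem a)
  rw [mul_inv_r, idem_inv_eq he]
  calc e * a = e * (e * (a * a⁻¹) * a) := by
        rw [mul_assoc e (a * a⁻¹), mul_inv_mul' a, ← mul_assoc, he]
    _ = e * ((a * a⁻¹) * e * a) := by rw [c]
    _ = _ := by simp only [mul_assoc]

theorem NatLE.trans {a b c : M} (h1 : NatLE a b) (h2 : NatLE b c) : NatLE a c := by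
  unfold NatLE at *
  have : a * a⁻¹ * (b * b⁻¹) * c = a := by
    rw [mul_assoc, ← h2]; exact h1.symm
  have h3 := idem_mul_le (e := a * a⁻¹ * (b * b⁻¹)) (by
    have c := comm_rr a b
    calc a * a⁻¹ * (b * b⁻¹) * (a * a⁻¹ * (b * b⁻¹))
        = a * a⁻¹ * ((b * b⁻¹) * (a * a⁻¹)) * (b * b⁻¹) := by simp only [mul_assoc]
      _ = (a * a⁻¹ * (a * a⁻¹)) * ((b * b⁻¹) * (b * b⁻¹)) := by
          rw [← c]; simp only [mul_assoc]
      _ = _ := by rw [rr_idem, rr_idem]) c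
  rw [this] at h3
  exact h3

theorem NatLE.antisymm {a b : M} (h1 : NatLE a b) (h2 : NatLE b a) : a = b := by
  unfold NatLE at *
  calc a = a * a⁻¹ * (b * b⁻¹ * a) := by rw [← h2]; exact h1
    _ = b * b⁻¹ * (a * a⁻¹) * a := by rw [← comm_rr]; simp only [mul_assoc]
    _ = b := by rw [mul_assoc, mul_inv_mul' a, ← h2]

theorem Sigma.refl (a : M) : Sigma a a := ⟨a, NatLE.refl a, NatLE.refl a⟩

theorem Sigma.symm {a b : M} : Sigma a b → Sigma b a := fun ⟨c, h1, h2⟩ => ⟨c, h2, h1⟩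

theorem Sigma.trans {a b c : M} : Sigma a b → Sigma b c → Sigma a c := by
  rintro ⟨d, d1, d2⟩ ⟨f, f1, f2⟩
  have hd : NatLE (f * f⁻¹ * d) d := idem_mul_le (rr_idem f) d
  have hf : NatLE (f * f⁻¹ * d) f := by
    have : f * f⁻¹ * d = d * d⁻¹ * f := by
      calc f * f⁻¹ * d = f * f⁻¹ * (d * d⁻¹ * b) := by rw [← show d = d * d⁻¹ * b from d2]
        _ = d * d⁻¹ * (f * f⁻¹ * b) := by rw [← mul_assoc, ← mul_assoc (d * d⁻¹), comm_rr]
        _ = d * d⁻¹ * f := by rw [← show f = f * f⁻¹ * b from f1]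
    rw [this]
    exact idem_mul_le (rr_idem d) f
  exact ⟨_, hd.trans d1, hf.trans f2⟩

theorem NatLE.eq_mul_right {a b : M} (h : NatLE a b) : a = b * (a⁻¹ * a) := by
  have ha : a⁻¹ * a = b⁻¹ * (a * a⁻¹) * b := by
    conv_lhs => rw [h]
    rw [mul_inv_r, rr_inv]
    calc b⁻¹ * (a * a⁻¹) * (a * a⁻¹ * b) = b⁻¹ * ((a * a⁻¹) * (a * a⁻¹)) * b := by
          simp only [mul_assoc]
      _ = _ := by rw [rr_idem]
  rw [ha]
  calc a = a * a⁻¹ * b := h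
    _ = a * a⁻¹ * (b * b⁻¹ * b) := by rw [mul_inv_mul' b]
    _ = a * a⁻¹ * (b * b⁻¹) * b := by simp only [mul_assoc]
    _ = b * b⁻¹ * (a * a⁻¹) * b := by rw [comm_rr]
    _ = _ := by simp only [mul_assoc]

theorem mul_idem_le (a : M) {e : M} (he : e * e = e) : NatLE (a * e) a := by
  have c : e * (a⁻¹ * a) = a⁻¹ * a * e := idem_comm he (by simpa using rr_idem a⁻¹)
  unfold NatLE
  rw [mul_inv_r, idem_inv_eq he]
  calc a * e = a * (a⁻¹ * a) * e := by rw [mul_inv_mul]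
    _ = a * (e * e * (a⁻¹ * a)) := by rw [he, c]; simp only [mul_assoc]
    _ = _ := by simp only [mul_assoc]

theorem NatLE.mul {a b c d : M} (h1 : NatLE a b) (h2 : NatLE c d) : NatLE (a * c) (b * d) := by
  have h2' := h2.eq_mul_right
  have hc : (c⁻¹ * c) * (c⁻¹ * c) = c⁻¹ * c := by simpa using rr_idem c⁻¹
  have e1 : a * c = a * a⁻¹ * (b * d * (c⁻¹ * c)) := by
    conv_lhs => rw [h1, h2']
    simp only [mul_assoc]
  rw [e1]
  exact (idem_mul_le (rr_idem a) _).trans (mul_idem_le _ hc)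

theorem NatLE.inv {a b : M} (h : NatLE a b) : NatLE a⁻¹ b⁻¹ := by
  have h' := congrArg (·⁻¹) h
  simp only [mul_inv_r, inv_inv] at h'
  rw [h']
  exact mul_idem_le _ (rr_idem a)

theorem Sigma.inv {a b : M} : Sigma a b → Sigma a⁻¹ b⁻¹ :=
  fun ⟨c, h1, h2⟩ => ⟨c⁻¹, h1.inv, h2.inv⟩

variable (M) in
/-- `σ` as a congruence. -/
def sigmaCon : Con M where
  r := Sigma
  iseqv := ⟨Sigma.refl, Sigma.symm, Sigma.trans⟩
  mul' := fun ⟨c, h1, h2⟩ ⟨d, h3, h4⟩ => ⟨c * d, h1.mul h3, h2.mul h4⟩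

variable (M) in
/-- The greatest group image `M/σ`. -/
def GroupImage : Type _ := (sigmaCon M).Quotient

instance : Group (GroupImage M) :=
  { (inferInstance : Monoid (sigmaCon M).Quotient) with
    inv := Quotient.map' (fun a => a⁻¹) (fun _ _ h => Sigma.inv h)
    inv_mul_cancel := by
      intro x
      induction x using Quotient.inductionOn' with
      | h a =>
        refine Quotient.sound' (s₁ := (sigmaCon M).toSetoid)
          (show Sigma (a⁻¹ * a) 1 from ⟨a⁻¹ * a, NatLE.refl _, ?_⟩)
        have := mul_idem_le (1 : M) (e := a⁻¹ * a) (by simpa using rr_idem a⁻¹)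
        rwa [one_mul] at this }

/-- The natural projection `σ♯ : M → M/σ`. -/
def sigmaMk : M →* GroupImage M := (sigmaCon M).mk'

end InverseMonoid

open InverseMonoid

/-- F-inverse monoids in the signature `(·, 1, ⁻¹, 𝔪)`: inverse monoids in which each `σ`-class has
a greatest element, `maxi s` being the greatest element of the `σ`-class of `s`. -/
class FInverseMonoid (M : Type*) extends InverseMonoid M where
  maxi : M → M
  isSigmaGreatest_maxi : ∀ s : M, IsSigmaGreatest s (maxi s)

namespace FInverseMonoid

theorem le_maxi {M : Type*} [FInverseMonoid M] (a : M) : NatLE a (maxi a) :=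
  (isSigmaGreatest_maxi a).2 a (Sigma.refl a)

theorem maxi_eq_of_sigma {M : Type*} [FInverseMonoid M] {a b : M} (h : Sigma a b) :
    maxi a = maxi b :=
  NatLE.antisymm
    ((isSigmaGreatest_maxi b).2 _ (h.symm.trans (isSigmaGreatest_maxi a).1))
    ((isSigmaGreatest_maxi a).2 _ (h.trans (isSigmaGreatest_maxi b).1))

theorem maxi_idem_mul {M : Type*} [FInverseMonoid M] (a b : M) :
    maxi (b * b⁻¹ * a) = maxi a :=
  maxi_eq_of_sigma ⟨_, NatLE.refl _, idem_mul_le (rr_idem b) a⟩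

/-- F-inverse monoids form a variety: the following two equations suffice. -/
abbrev ofEquations {M : Type*} [InverseMonoid M] (m : M → M)
    (h1 : ∀ a, a = a * a⁻¹ * m a) (h2 : ∀ a b, m (b * b⁻¹ * a) = m a) : FInverseMonoid M where
  maxi := m
  isSigmaGreatest_maxi s := by
    have key : ∀ {a b : M}, NatLE a b → m a = m b := fun {a b} h => by
      have h' : a = a * a⁻¹ * b := h
      rw [h', h2]
    refine ⟨⟨s, NatLE.refl s, h1 s⟩, ?_⟩
    rintro t ⟨c, hs, ht⟩
    rw [← key hs, key ht]
    exact h1 t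

end FInverseMonoid

open FInverseMonoid

/-! ## Words, terms and their values -/

/-- Words over `X ∪ X⁻¹`; the letter `(x, true)` is `x` and `(x, false)` is `x⁻¹`. -/
abbrev InvWord (X : Type u) : Type u := List (X × Bool)

/-- The set `𝕀𝔪_X` of formal expressions `u₀ v₁^𝔪 u₁ ⋯ vₙ^𝔪 uₙ` with `uᵢ, vᵢ` words over
`X ∪ X⁻¹`, as words over the disjoint union of the letters and of the symbols `v^𝔪`. -/
abbrev ImTerm (X : Type u) : Type u := List ((X × Bool) ⊕ InvWord X)

/-- The freely reduced form of a word. -/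
def red {X : Type u} (w : InvWord X) : InvWord X :=
  letI := Classical.decEq X
  FreeGroup.reduce w

/-- A word as a term. -/
def ImTerm.ofWord {X : Type u} (w : InvWord X) : ImTerm X := w.map Sum.inl

/-- The term `w^𝔪` for a word `w`. -/
def ImTerm.maxWord {X : Type u} (w : InvWord X) : ImTerm X := [Sum.inr w]

/-- The value of a letter of `X ∪ X⁻¹`. -/
def letterVal {X : Type u} {M : Type v} [Inv M] (ι : X → M) (a : X × Bool) : M :=
  if a.2 then ι a.1 else (ι a.1)⁻¹

/-- The value `w_S` of a word `w`. -/
def wordVal {X : Type u} {M : Type v} [Monoid M] [Inv M] (ι : X → M) (w : InvWord X) : M :=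
  (w.map (letterVal ι)).prod

/-- The value `w_S` of a term `w`, the operation `𝔪` being interpreted as `m`. -/
def ImTerm.val {X : Type u} {M : Type v} [Monoid M] [Inv M] (m : M → M) (ι : X → M)
    (w : ImTerm X) : M :=
  (w.map (Sum.elim (letterVal ι) (fun v => m (wordVal ι v)))).prod

/-! ## The free inverse monoid -/

/-- The defining relations of the Vagner congruence on the free monoid with involution. -/
inductive VagnerRel (X : Type u) : FreeMonoid (X × Bool) → FreeMonoid (X × Bool) → Prop
  | regular (w : InvWord X) :
      VagnerRel X (.ofList (w ++ FreeGroup.invRev w ++ w)) (.ofList w)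
  | comm (w z : InvWord X) :
      VagnerRel X (.ofList (w ++ FreeGroup.invRev w ++ (z ++ FreeGroup.invRev z)))
        (.ofList (z ++ FreeGroup.invRev z ++ (w ++ FreeGroup.invRev w)))

/-- The free inverse monoid on `X`: the quotient of the free monoid with involution
`(X ∪ X⁻¹)*` by the Vagner congruence. -/
def FreeInverseMonoid (X : Type u) : Type u := (conGen (VagnerRel X)).Quotient

namespace FreeInverseMonoid

variable {X : Type u}

theorem invRev_rel {a b : FreeMonoid (X × Bool)} (h : ConGen.Rel (VagnerRel X) a b) :
    ConGen.Rel (VagnerRel X) (.ofList (FreeGroup.invRev a.toList))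
      (.ofList (FreeGroup.invRev b.toList)) := by
  induction h with
  | of x y h =>
    cases h with
    | regular w =>
      have := ConGen.Rel.of _ _ (VagnerRel.regular (FreeGroup.invRev w))
      simpa [FreeGroup.invRev_append, FreeGroup.invRev_invRev, List.append_assoc] using this
    | comm w z =>
      have := ConGen.Rel.of _ _ (VagnerRel.comm z w)
      simpa [FreeGroup.invRev_append, FreeGroup.invRev_invRev, List.append_assoc] using this
  | refl x => exact .refl _
  | symm _ ih => exact .symm ih
  | trans _ _ ih1 ih2 => exact .trans ih1 ih2
  | mul _ _ ih1 ih2 =>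
    have := ConGen.Rel.mul ih2 ih1
    simpa [FreeMonoid.toList_mul, FreeGroup.invRev_append, FreeMonoid.ofList_append] using this

/-- The class of a word. -/
def mk (w : InvWord X) : FreeInverseMonoid X :=
  Quotient.mk (conGen (VagnerRel X)).toSetoid (FreeMonoid.ofList w)

theorem mk_sound {a b : FreeMonoid (X × Bool)} (h : VagnerRel X a b) :
    mk a.toList = mk b.toList := Quotient.sound (ConGen.Rel.of _ _ h)

theorem ind {p : FreeInverseMonoid X → Prop} (h : ∀ w, p (mk w)) (s : FreeInverseMonoid X) :
    p s := Quotient.inductionOn s h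

instance : Monoid (FreeInverseMonoid X) :=
  inferInstanceAs (Monoid (conGen (VagnerRel X)).Quotient)

instance : Inv (FreeInverseMonoid X) where
  inv := Quotient.map (fun a => FreeMonoid.ofList (FreeGroup.invRev a.toList))
    (fun _ _ h => invRev_rel h)

theorem mk_mul (w z : InvWord X) : mk w * mk z = mk (w ++ z) := rfl

theorem mk_inv (w : InvWord X) : (mk w)⁻¹ = mk (FreeGroup.invRev w) := rfl

instance : InverseMonoid (FreeInverseMonoid X) where
  inv_inv := ind fun w => by rw [mk_inv, mk_inv, FreeGroup.invRev_invRev]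
  mul_inv_rev' := ind fun w => ind fun z => by
    rw [mk_mul, mk_inv, mk_inv, mk_inv, mk_mul, FreeGroup.invRev_append]
  mul_inv_mul' := ind fun w => mk_sound (VagnerRel.regular w)
  idem_comm' := ind fun w => ind fun z => mk_sound (VagnerRel.comm w z)

/-- The generators of the free inverse monoid. -/
def of (x : X) : FreeInverseMonoid X := mk [(x, true)]

end FreeInverseMonoid

/-! ## The free F-inverse monoid and presentations -/

/-- Terms over `X` in the signature `(·, 1, ⁻¹, 𝔪)`. -/
inductive FTerm (X : Type u) : Type u
  | of : X → FTerm X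
  | one : FTerm X
  | mul : FTerm X → FTerm X → FTerm X
  | inv : FTerm X → FTerm X
  | maxi : FTerm X → FTerm X

/-- Equality of terms modulo the identities of F-inverse monoids. -/
inductive FTerm.Rel {X : Type u} : FTerm X → FTerm X → Prop
  | refl (a) : Rel a a
  | symm {a b} : Rel a b → Rel b a
  | trans {a b c} : Rel a b → Rel b c → Rel a c
  | mul_congr {a b c d} : Rel a b → Rel c d → Rel (mul a c) (mul b d)
  | inv_congr {a b} : Rel a b → Rel (inv a) (inv b)
  | maxi_congr {a b} : Rel a b → Rel (maxi a) (maxi b)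
  | mul_assoc (a b c) : Rel (mul (mul a b) c) (mul a (mul b c))
  | one_mul (a) : Rel (mul one a) a
  | mul_one (a) : Rel (mul a one) a
  | inv_inv (a) : Rel (inv (inv a)) a
  | mul_inv_rev (a b) : Rel (inv (mul a b)) (mul (inv b) (inv a))
  | mul_inv_mul (a) : Rel (mul (mul a (inv a)) a) a
  | idem_comm (a b) : Rel (mul (mul a (inv a)) (mul b (inv b)))
      (mul (mul b (inv b)) (mul a (inv a)))
  | le_maxi (a) : Rel a (mul (mul a (inv a)) (maxi a))
  | maxi_idem_mul (a b) : Rel (maxi (mul (mul b (inv b)) a)) (maxi a)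

/-- The setoid of `FTerm.Rel`. -/
def FTerm.setoid (X : Type u) : Setoid (FTerm X) where
  r := FTerm.Rel
  iseqv := ⟨.refl, .symm, .trans⟩

/-- The free F-inverse monoid on `X`. -/
def FreeFInverseMonoid (X : Type u) : Type u := Quotient (FTerm.setoid X)

namespace FreeFInverseMonoid

variable {X : Type u}

instance : InverseMonoid (FreeFInverseMonoid X) where
  mul := Quotient.map₂ FTerm.mul (fun _ _ h1 _ _ h2 => .mul_congr h1 h2)
  one := Quotient.mk _ FTerm.one
  inv := Quotient.map FTerm.inv (fun _ _ h => .inv_congr h)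
  mul_assoc := by rintro ⟨a⟩ ⟨b⟩ ⟨c⟩; exact Quotient.sound (.mul_assoc a b c)
  one_mul := by rintro ⟨a⟩; exact Quotient.sound (.one_mul a)
  mul_one := by rintro ⟨a⟩; exact Quotient.sound (.mul_one a)
  inv_inv := by rintro ⟨a⟩; exact Quotient.sound (.inv_inv a)
  mul_inv_rev' := by rintro ⟨a⟩ ⟨b⟩; exact Quotient.sound (.mul_inv_rev a b)
  mul_inv_mul' := by rintro ⟨a⟩; exact Quotient.sound (.mul_inv_mul a)
  idem_comm' := by rintro ⟨a⟩ ⟨b⟩; exact Quotient.sound (.idem_comm a b)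

instance : FInverseMonoid (FreeFInverseMonoid X) :=
  FInverseMonoid.ofEquations
    (Quotient.map FTerm.maxi (fun _ _ h => .maxi_congr h))
    (by rintro ⟨a⟩; exact Quotient.sound (.le_maxi a))
    (by rintro ⟨a⟩ ⟨b⟩; exact Quotient.sound (.maxi_idem_mul a b))

/-- The generators of the free F-inverse monoid. -/
def of (x : X) : FreeFInverseMonoid X := Quotient.mk _ (FTerm.of x)

/-- The value of a term in an F-inverse monoid. -/
def eval {M : Type v} [FInverseMonoid M] (ι : X → M) : FTerm X → M
  | .of x => ι x
  | .one => 1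
  | .mul a b => eval ι a * eval ι b
  | .inv a => (eval ι a)⁻¹
  | .maxi a => FInverseMonoid.maxi (eval ι a)

theorem eval_rel {M : Type v} [FInverseMonoid M] (ι : X → M) {a b : FTerm X}
    (h : FTerm.Rel a b) : eval ι a = eval ι b := by
  induction h with
  | refl _ => rfl
  | symm _ ih => exact ih.symm
  | trans _ _ ih1 ih2 => exact ih1.trans ih2
  | mul_congr _ _ ih1 ih2 => simp only [eval, ih1, ih2]
  | inv_congr _ ih => simp only [eval, ih]
  | maxi_congr _ ih => simp only [eval, ih]
  | mul_assoc a b c => exact _root_.mul_assoc _ _ _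
  | one_mul a => exact _root_.one_mul _
  | mul_one a => exact _root_.mul_one _
  | inv_inv a => exact _root_.inv_inv _
  | mul_inv_rev a b => exact mul_inv_r _ _
  | mul_inv_mul a => exact InverseMonoid.mul_inv_mul' _
  | idem_comm a b => exact InverseMonoid.idem_comm' _ _
  | le_maxi a => exact FInverseMonoid.le_maxi _
  | maxi_idem_mul a b => exact FInverseMonoid.maxi_idem_mul _ _

/-- `FreeFInverseMonoid X` is free on `X` in the class of F-inverse monoids. -/
theorem existsUnique_lift {M : Type v} [FInverseMonoid M] (ι : X → M) :
    ∃! φ : FreeFInverseMonoid X →* M, (∀ s, φ s⁻¹ = (φ s)⁻¹) ∧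
      (∀ s, φ (maxi s) = maxi (φ s)) ∧ ∀ x, φ (of x) = ι x := by
  refine ⟨{ toFun := Quotient.lift (eval ι) (fun _ _ h => eval_rel ι h), map_one' := rfl,
            map_mul' := by rintro ⟨a⟩ ⟨b⟩; rfl }, ⟨?_, ?_, fun x => rfl⟩, ?_⟩
  · rintro ⟨a⟩; rfl
  · rintro ⟨a⟩; rfl
  · rintro ψ ⟨h1, h2, h3⟩
    ext ⟨a⟩
    change ψ (Quotient.mk _ a) = eval ι a
    induction a with
    | of x => exact h3 x
    | one => exact ψ.map_one
    | mul a b iha ihb => exact (ψ.map_mul _ _).trans (congrArg₂ _ iha ihb)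
    | inv a ih => exact (h1 _).trans (congrArg _ ih)
    | maxi a ih => exact (h2 _).trans (congrArg _ ih)

end FreeFInverseMonoid

/-- The congruence (for the signature `(·, 1, ⁻¹, 𝔪)`) on an F-inverse monoid generated by a
relation. -/
inductive FCongGen {M : Type u} [FInverseMonoid M] (r : M → M → Prop) : M → M → Prop
  | of {a b} : r a b → FCongGen r a b
  | refl (a) : FCongGen r a a
  | symm {a b} : FCongGen r a b → FCongGen r b a
  | trans {a b c} : FCongGen r a b → FCongGen r b c → FCongGen r a c
  | mul {a b c d} : FCongGen r a b → FCongGen r c d → FCongGen r (a * c) (b * d)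
  | inv {a b} : FCongGen r a b → FCongGen r a⁻¹ b⁻¹
  | maxi {a b} : FCongGen r a b → FCongGen r (maxi a) (maxi b)

/-- The setoid of `FCongGen r`. -/
def FCongGen.setoid {M : Type u} [FInverseMonoid M] (r : M → M → Prop) : Setoid M where
  r := FCongGen r
  iseqv := ⟨.refl, .symm, .trans⟩

/-- The quotient of an F-inverse monoid by the congruence generated by a relation. -/
def FQuotient {M : Type u} [FInverseMonoid M] (r : M → M → Prop) : Type u :=
  Quotient (FCongGen.setoid r)

namespace FQuotient

variable {M : Type u} [FInverseMonoid M] (r : M → M → Prop)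

/-- The class of an element. -/
def mk (a : M) : FQuotient r := Quotient.mk _ a

instance : InverseMonoid (FQuotient r) where
  mul := Quotient.map₂ (· * ·) (fun _ _ h1 _ _ h2 => .mul h1 h2)
  one := mk r 1
  inv := Quotient.map (·⁻¹) (fun _ _ h => .inv h)
  mul_assoc := by rintro ⟨a⟩ ⟨b⟩ ⟨c⟩; exact congrArg (mk r) (mul_assoc a b c)
  one_mul := by rintro ⟨a⟩; exact congrArg (mk r) (one_mul a)
  mul_one := by rintro ⟨a⟩; exact congrArg (mk r) (mul_one a)
  inv_inv := by rintro ⟨a⟩; exact congrArg (mk r) (inv_inv a)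
  mul_inv_rev' := by rintro ⟨a⟩ ⟨b⟩; exact congrArg (mk r) (mul_inv_rev' a b)
  mul_inv_mul' := by rintro ⟨a⟩; exact congrArg (mk r) (mul_inv_mul' a)
  idem_comm' := by rintro ⟨a⟩ ⟨b⟩; exact congrArg (mk r) (idem_comm' a b)

instance : FInverseMonoid (FQuotient r) :=
  FInverseMonoid.ofEquations
    (Quotient.map maxi (fun _ _ h => .maxi h))
    (by rintro ⟨a⟩; exact congrArg (mk r) (le_maxi a))
    (by rintro ⟨a⟩ ⟨b⟩; exact congrArg (mk r) (maxi_idem_mul a b))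

end FQuotient

/-- A relation on terms, read in the free F-inverse monoid. -/
def termRel {X : Type u} (R : ImTerm X → ImTerm X → Prop)
    (a b : FreeFInverseMonoid X) : Prop :=
  ∃ p q, R p q ∧ a = ImTerm.val maxi FreeFInverseMonoid.of p ∧
    b = ImTerm.val maxi FreeFInverseMonoid.of q

/-- The F-inverse monoid `FInv⟨X ∣ R⟩`: the quotient of the free F-inverse monoid on `X` by the
congruence generated by `R`. -/
abbrev FInvPres {X : Type u} (R : ImTerm X → ImTerm X → Prop) : Type u := FQuotient (termRel R)

/-- The generators of `FInv⟨X ∣ R⟩`. -/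
def FInvPres.of {X : Type u} (R : ImTerm X → ImTerm X → Prop) (x : X) : FInvPres R :=
  FQuotient.mk _ (FreeFInverseMonoid.of x)

/-! ## Cayley graphs of groups and their subgraphs -/

/-- The formal inverse of a letter. -/
def letterInv {X : Type u} (a : X × Bool) : X × Bool := (a.1, !a.2)

theorem letterVal_letterInv {X : Type u} {G : Type v} [Group G] (ι : X → G) (a : X × Bool) :
    letterVal ι (letterInv a) = (letterVal ι a)⁻¹ := by
  rcases a with ⟨x, _ | _⟩ <;> simp [letterVal, letterInv]

/-- Subgraphs of the Cayley graph of the group `G` with respect to `ι : X → G`.  The vertices of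
the Cayley graph are the elements of `G`, and its edges are the pairs `(g, a)` with `g ∈ G` and
`a ∈ X ∪ X⁻¹`, where `(g, a)` has label `a`, starts at `g`, ends at `g a_G` and has inverse
`(g a_G, a⁻¹)`. -/
@[ext]
structure CayleySubgraph {X : Type u} {G : Type v} [Group G] (ι : X → G) where
  verts : Set G
  edges : Set (G × (X × Bool))
  source_mem : ∀ g a, (g, a) ∈ edges → g ∈ verts
  target_mem : ∀ g a, (g, a) ∈ edges → g * letterVal ι a ∈ verts
  inv_mem : ∀ g a, (g, a) ∈ edges → (g * letterVal ι a, letterInv a) ∈ edges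

namespace CayleySubgraph

variable {X : Type u} {G : Type v} [Group G] {ι : X → G}

instance : PartialOrder (CayleySubgraph ι) where
  le Δ Ξ := Δ.verts ⊆ Ξ.verts ∧ Δ.edges ⊆ Ξ.edges
  le_refl _ := ⟨subset_rfl, subset_rfl⟩
  le_trans _ _ _ h1 h2 := ⟨h1.1.trans h2.1, h1.2.trans h2.2⟩
  le_antisymm _ _ h1 h2 := CayleySubgraph.ext (h1.1.antisymm h2.1) (h1.2.antisymm h2.2)

instance : Max (CayleySubgraph ι) where
  max Δ Ξ :=
    { verts := Δ.verts ∪ Ξ.verts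
      edges := Δ.edges ∪ Ξ.edges
      source_mem := fun g a h => h.imp (Δ.source_mem g a) (Ξ.source_mem g a)
      target_mem := fun g a h => h.imp (Δ.target_mem g a) (Ξ.target_mem g a)
      inv_mem := fun g a h => h.imp (Δ.inv_mem g a) (Ξ.inv_mem g a) }

instance : Min (CayleySubgraph ι) where
  min Δ Ξ :=
    { verts := Δ.verts ∩ Ξ.verts
      edges := Δ.edges ∩ Ξ.edges
      source_mem := fun g a h => h.imp (Δ.source_mem g a) (Ξ.source_mem g a)
      target_mem := fun g a h => h.imp (Δ.target_mem g a) (Ξ.target_mem g a)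
      inv_mem := fun g a h => h.imp (Δ.inv_mem g a) (Ξ.inv_mem g a) }

instance : SupSet (CayleySubgraph ι) where
  sSup s :=
    { verts := {g | ∃ Δ ∈ s, g ∈ Δ.verts}
      edges := {e | ∃ Δ ∈ s, e ∈ Δ.edges}
      source_mem := fun g a ⟨Δ, hΔ, h⟩ => ⟨Δ, hΔ, Δ.source_mem g a h⟩
      target_mem := fun g a ⟨Δ, hΔ, h⟩ => ⟨Δ, hΔ, Δ.target_mem g a h⟩
      inv_mem := fun g a ⟨Δ, hΔ, h⟩ => ⟨Δ, hΔ, Δ.inv_mem g a h⟩ }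

instance : InfSet (CayleySubgraph ι) where
  sInf s :=
    { verts := {g | ∀ Δ ∈ s, g ∈ Δ.verts}
      edges := {e | ∀ Δ ∈ s, e ∈ Δ.edges}
      source_mem := fun g a h Δ hΔ => Δ.source_mem g a (h Δ hΔ)
      target_mem := fun g a h Δ hΔ => Δ.target_mem g a (h Δ hΔ)
      inv_mem := fun g a h Δ hΔ => Δ.inv_mem g a (h Δ hΔ) }

instance : Top (CayleySubgraph ι) where
  top := ⟨Set.univ, Set.univ, fun _ _ _ => trivial, fun _ _ _ => trivial, fun _ _ _ => trivial⟩

instance : Bot (CayleySubgraph ι) where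
  bot := ⟨∅, ∅, fun _ _ h => h.elim, fun _ _ h => h.elim, fun _ _ h => h.elim⟩

/-- The complete lattice `Sub Γ_X` of all subgraphs, under inclusion. -/
instance : CompleteLattice (CayleySubgraph ι) where
  sup := max
  inf := min
  le_sup_left _ _ := ⟨Set.subset_union_left, Set.subset_union_left⟩
  le_sup_right _ _ := ⟨Set.subset_union_right, Set.subset_union_right⟩
  sup_le _ _ _ h1 h2 := ⟨Set.union_subset h1.1 h2.1, Set.union_subset h1.2 h2.2⟩
  inf_le_left _ _ := ⟨Set.inter_subset_left, Set.inter_subset_left⟩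
  inf_le_right _ _ := ⟨Set.inter_subset_right, Set.inter_subset_right⟩
  le_inf _ _ _ h1 h2 := ⟨Set.subset_inter h1.1 h2.1, Set.subset_inter h1.2 h2.2⟩
  isLUB_sSup s := ⟨fun Δ hΔ => ⟨fun _ h => ⟨Δ, hΔ, h⟩, fun _ h => ⟨Δ, hΔ, h⟩⟩,
    fun _ hΞ => ⟨fun _ ⟨_, hΔ, h⟩ => (hΞ hΔ).1 h, fun _ ⟨_, hΔ, h⟩ => (hΞ hΔ).2 h⟩⟩
  isGLB_sInf s := ⟨fun Δ hΔ => ⟨fun _ h => h Δ hΔ, fun _ h => h Δ hΔ⟩,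
    fun _ hΞ => ⟨fun _ h _ hΔ => (hΞ hΔ).1 h, fun _ h _ hΔ => (hΞ hΔ).2 h⟩⟩
  le_top _ := ⟨fun _ _ => trivial, fun _ _ => trivial⟩
  bot_le _ := ⟨fun _ h => h.elim, fun _ h => h.elim⟩

/-- The left action of `G` on the subgraphs of its Cayley graph: `gΔ`. -/
instance : MulAction G (CayleySubgraph ι) where
  smul g Δ :=
    { verts := {h | g⁻¹ * h ∈ Δ.verts}
      edges := {e | (g⁻¹ * e.1, e.2) ∈ Δ.edges}
      source_mem := fun _ _ he => Δ.source_mem _ _ he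
      target_mem := fun _ _ he => by
        have := Δ.target_mem _ _ he
        rwa [mul_assoc] at this
      inv_mem := fun _ _ he => by
        have := Δ.inv_mem _ _ he
        rwa [mul_assoc] at this }
  one_smul Δ := by
    apply CayleySubgraph.ext
    · ext h; change (1 : G)⁻¹ * h ∈ Δ.verts ↔ _; simp
    · ext ⟨h, a⟩; change ((1 : G)⁻¹ * h, a) ∈ Δ.edges ↔ _; simp
  mul_smul g k Δ := by
    apply CayleySubgraph.ext
    · ext h; change (g * k)⁻¹ * h ∈ Δ.verts ↔ k⁻¹ * (g⁻¹ * h) ∈ Δ.verts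
      rw [mul_inv_rev, mul_assoc]
    · ext ⟨h, a⟩
      change ((g * k)⁻¹ * h, a) ∈ Δ.edges ↔ (k⁻¹ * (g⁻¹ * h), a) ∈ Δ.edges
      rw [mul_inv_rev, mul_assoc]

theorem mem_smul_verts {g h : G} {Δ : CayleySubgraph ι} :
    h ∈ (g • Δ).verts ↔ g⁻¹ * h ∈ Δ.verts := Iff.rfl

theorem mem_smul_edges {g h : G} {a : X × Bool} {Δ : CayleySubgraph ι} :
    (h, a) ∈ (g • Δ).edges ↔ (g⁻¹ * h, a) ∈ Δ.edges := Iff.rfl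

theorem smul_mono {g : G} {Δ Ξ : CayleySubgraph ι} (h : Δ ≤ Ξ) : g • Δ ≤ g • Ξ :=
  ⟨fun _ hv => h.1 hv, fun _ he => h.2 he⟩

theorem smul_sup (g : G) (Δ Ξ : CayleySubgraph ι) : g • (Δ ⊔ Ξ) = g • Δ ⊔ g • Ξ := rfl

/-- A subgraph is finite if it has finitely many vertices and edges. -/
def IsFinite (Δ : CayleySubgraph ι) : Prop := Δ.verts.Finite ∧ Δ.edges.Finite

theorem IsFinite.sup {Δ Ξ : CayleySubgraph ι} (h1 : Δ.IsFinite) (h2 : Ξ.IsFinite) :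
    (Δ ⊔ Ξ).IsFinite := ⟨h1.1.union h2.1, h1.2.union h2.2⟩

theorem IsFinite.smul {Δ : CayleySubgraph ι} (h : Δ.IsFinite) (g : G) : (g • Δ).IsFinite := by
  refine ⟨h.1.preimage (mul_right_injective g⁻¹).injOn,
    h.2.preimage (f := fun e : G × (X × Bool) => (g⁻¹ * e.1, e.2)) ?_⟩
  rintro ⟨a, b⟩ _ ⟨c, d⟩ _ hab
  simpa using hab

/-- The word `w` labels a path from `g` to `h` in `Δ`. -/
def LabelsPath (Δ : CayleySubgraph ι) : InvWord X → G → G → Prop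
  | [], g, h => g ∈ Δ.verts ∧ g = h
  | a :: w, g, h => (g, a) ∈ Δ.edges ∧ LabelsPath Δ w (g * letterVal ι a) h

/-- The term `w` labels a journey from `g` to `h` in `Δ`: a letter traverses an edge of `Δ`, and a
symbol `v^𝔪` jumps from the current position `k` to `k v_G`, all positions being vertices
of `Δ`. -/
def LabelsJourney (Δ : CayleySubgraph ι) : ImTerm X → G → G → Prop
  | [], g, h => g ∈ Δ.verts ∧ g = h
  | Sum.inl a :: w, g, h => (g, a) ∈ Δ.edges ∧ LabelsJourney Δ w (g * letterVal ι a) h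
  | Sum.inr v :: w, g, h => g ∈ Δ.verts ∧ LabelsJourney Δ w (g * wordVal ι v) h

/-- Any two vertices are joined by a path; the empty subgraph is included. -/
def Connected (Δ : CayleySubgraph ι) : Prop :=
  ∀ g ∈ Δ.verts, ∀ h ∈ Δ.verts, ∃ w, Δ.LabelsPath w g h

/-- `Δ` is closed with respect to `R`: for every pair in `R` and all vertices `g`, `h` of `Δ`, one
term of the pair labels a journey from `g` to `h` in `Δ` if and only if the other one does. -/
def RelClosed (R : ImTerm X → ImTerm X → Prop) (Δ : CayleySubgraph ι) : Prop :=
  ∀ p q, R p q → ∀ g ∈ Δ.verts, ∀ h ∈ Δ.verts, Δ.LabelsJourney p g h ↔ Δ.LabelsJourney q g h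

/-- The subgraph consisting of the single vertex `g`. -/
def vertex (ι : X → G) (g : G) : CayleySubgraph ι :=
  ⟨{g}, ∅, fun _ _ h => h.elim, fun _ _ h => h.elim, fun _ _ h => h.elim⟩

/-- The subgraph spanned by the edge `(g, a)`. -/
def edge (ι : X → G) (g : G) (a : X × Bool) : CayleySubgraph ι where
  verts := {g, g * letterVal ι a}
  edges := {(g, a), (g * letterVal ι a, letterInv a)}
  source_mem := by
    rintro h b (hb | hb) <;> (cases hb; simp)
  target_mem := by
    rintro h b (hb | hb) <;> (cases hb; simp [letterVal_letterInv])
  inv_mem := by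
    rintro h b (hb | hb) <;> cases hb
    · exact Or.inr rfl
    · refine Or.inl ?_
      rw [letterVal_letterInv, mul_inv_cancel_right]
      simp [letterInv]

/-- The subgraph `⟨g w̄⟩` spanned by the path labelled by the word `w` starting at `g`. -/
def pathSpan (ι : X → G) : G → InvWord X → CayleySubgraph ι
  | g, [] => vertex ι g
  | g, a :: w => edge ι g a ⊔ pathSpan ι (g * letterVal ι a) w

theorem labelsJourney_smul (k : G) (Δ : CayleySubgraph ι) (p : ImTerm X) (g h : G) :
    (k • Δ).LabelsJourney p g h ↔ Δ.LabelsJourney p (k⁻¹ * g) (k⁻¹ * h) := by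
  induction p generalizing g with
  | nil => simp [LabelsJourney, mem_smul_verts]
  | cons a p ih =>
    rcases a with a | v
    · simp [LabelsJourney, mem_smul_edges, ih, mul_assoc]
    · simp [LabelsJourney, mem_smul_verts, ih, mul_assoc]

theorem RelClosed.smul {R : ImTerm X → ImTerm X → Prop} {Δ : CayleySubgraph ι}
    (h : Δ.RelClosed R) (k : G) : (k • Δ).RelClosed R := by
  intro p q hpq g hg l hl
  rw [labelsJourney_smul, labelsJourney_smul]
  exact h p q hpq _ hg _ hl

theorem labelsJourney_end {Δ : CayleySubgraph ι} {p : ImTerm X} {g h : G}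
    (hp : Δ.LabelsJourney p g h) : g * p.val id ι = h := by
  induction p generalizing g with
  | nil => simpa [ImTerm.val] using hp.2
  | cons a p ih =>
    have key : g * ImTerm.val id ι (a :: p) =
        g * Sum.elim (letterVal ι) (fun v => id (wordVal ι v)) a * ImTerm.val id ι p := by
      simp [ImTerm.val, mul_assoc]
    rw [key]
    rcases a with a | v <;> exact ih hp.2

theorem labelsJourney_top (p : ImTerm X) (g : G) :
    (⊤ : CayleySubgraph ι).LabelsJourney p g (g * p.val id ι) := by
  induction p generalizing g with
  | nil => exact ⟨trivial, by simp [ImTerm.val]⟩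
  | cons a p ih =>
    have key : g * ImTerm.val id ι (a :: p) =
        g * Sum.elim (letterVal ι) (fun v => id (wordVal ι v)) a * ImTerm.val id ι p := by
      simp [ImTerm.val, mul_assoc]
    rw [key]
    rcases a with a | v <;> exact ⟨trivial, ih _⟩

theorem labelsJourney_sInf {s : Set (CayleySubgraph ι)} (hs : s.Nonempty) (p : ImTerm X)
    (g h : G) : (sInf s).LabelsJourney p g h ↔ ∀ Δ ∈ s, Δ.LabelsJourney p g h := by
  obtain ⟨Δ₀, h₀⟩ := hs
  induction p generalizing g with
  | nil => exact ⟨fun hp Δ hΔ => ⟨hp.1 Δ hΔ, hp.2⟩,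
      fun hp => ⟨fun Δ hΔ => (hp Δ hΔ).1, (hp Δ₀ h₀).2⟩⟩
  | cons a p ih =>
    rcases a with a | v
    · exact ⟨fun hp Δ hΔ => ⟨hp.1 Δ hΔ, (ih _).1 hp.2 Δ hΔ⟩,
        fun hp => ⟨fun Δ hΔ => (hp Δ hΔ).1, (ih _).2 fun Δ hΔ => (hp Δ hΔ).2⟩⟩
    · exact ⟨fun hp Δ hΔ => ⟨hp.1 Δ hΔ, (ih _).1 hp.2 Δ hΔ⟩,
        fun hp => ⟨fun Δ hΔ => (hp Δ hΔ).1, (ih _).2 fun Δ hΔ => (hp Δ hΔ).2⟩⟩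

end CayleySubgraph

/-! ## Closure operators and the associated monoids -/

/-- `G`-invariant closure operators on the subgraphs of a Cayley graph. -/
structure InvariantClosure {X : Type u} {G : Type v} [Group G] (ι : X → G) where
  op : ClosureOperator (CayleySubgraph ι)
  map_smul : ∀ (g : G) (Δ : CayleySubgraph ι), op (g • Δ) = g • op Δ

/-- The closure operator `c_R`, whose closed elements are the subgraphs closed with respect to `R`,
for a relation `R` any two related terms of which are equal in `G`. -/
def relClosure {X : Type u} {G : Type v} [Group G] (ι : X → G) (R : ImTerm X → ImTerm X → Prop)
    (hR : ∀ p q, R p q → p.val id ι = q.val id ι) : InvariantClosure ι :=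
  let c := ClosureOperator.ofCompletePred (CayleySubgraph.RelClosed (ι := ι) R) (by
    intro s hs p q hpq g hg h hh
    rcases s.eq_empty_or_nonempty with rfl | hne
    · rw [sInf_empty]
      constructor
      · intro hp
        rw [← CayleySubgraph.labelsJourney_end hp, hR p q hpq]
        exact CayleySubgraph.labelsJourney_top q g
      · intro hp
        rw [← CayleySubgraph.labelsJourney_end hp, ← hR p q hpq]
        exact CayleySubgraph.labelsJourney_top p g
    · rw [CayleySubgraph.labelsJourney_sInf hne, CayleySubgraph.labelsJourney_sInf hne]
      exact forall₂_congr fun Δ hΔ => hs Δ hΔ p q hpq g (hg Δ hΔ) h (hh Δ hΔ))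
  { op := c
    map_smul := by
      have hc : ∀ (g : G) (Δ : CayleySubgraph ι), c (g • Δ) ≤ g • c Δ := fun g Δ =>
        ClosureOperator.closure_min (CayleySubgraph.smul_mono (c.le_closure Δ))
          (CayleySubgraph.RelClosed.smul (c.isClosed_closure Δ) g)
      intro g Δ
      refine (hc g Δ).antisymm ?_
      have h := CayleySubgraph.smul_mono (g := g) (hc g⁻¹ (g • Δ))
      rwa [inv_smul_smul, smul_inv_smul] at h }

/-- The compact subgraphs: the closures of finite subgraphs. -/
def IsCompactSubgraph {X : Type u} {G : Type v} [Group G] {ι : X → G} (c : InvariantClosure ι)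
    (Δ : CayleySubgraph ι) : Prop :=
  ∃ F : CayleySubgraph ι, F.IsFinite ∧ Δ = c.op F

/-- The set `S_c` of the pairs `(Δ, g)` with `g ∈ G` and `Δ` a compact subgraph containing the
vertices `1` and `g`. -/
@[ext]
structure ClosureMonoid {X : Type u} {G : Type v} [Group G] {ι : X → G}
    (c : InvariantClosure ι) where
  graph : CayleySubgraph ι
  elt : G
  compact : IsCompactSubgraph c graph
  one_mem : 1 ∈ graph.verts
  elt_mem : elt ∈ graph.verts

namespace ClosureMonoid

variable {X : Type u} {G : Type v} [Group G] {ι : X → G} {c : InvariantClosure ι}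

/-- `(Δ, g)(Ξ, h) = ((Δ ∪ gΞ)^c, gh)`. -/
instance : Mul (ClosureMonoid c) where
  mul s t :=
    { graph := c.op (s.graph ⊔ s.elt • t.graph)
      elt := s.elt * t.elt
      compact := by
        obtain ⟨F, hF, hs⟩ := s.compact
        obtain ⟨H, hH, ht⟩ := t.compact
        refine ⟨F ⊔ s.elt • H, hF.sup (hH.smul _), ?_⟩
        rw [hs, ht, ← c.map_smul, ClosureOperator.closure_sup_closure]
      one_mem := (c.op.le_closure _).1 (Or.inl s.one_mem)
      elt_mem := (c.op.le_closure _).1 (Or.inr (by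
        rw [CayleySubgraph.mem_smul_verts, inv_mul_cancel_left]; exact t.elt_mem)) }

/-- `({1}^c, 1)`. -/
instance : One (ClosureMonoid c) where
  one :=
    { graph := c.op (CayleySubgraph.vertex ι 1)
      elt := 1
      compact := ⟨_, ⟨Set.finite_singleton _, Set.finite_empty⟩, rfl⟩
      one_mem := (c.op.le_closure _).1 rfl
      elt_mem := (c.op.le_closure _).1 rfl }

/-- `(Δ, g)⁻¹ = (g⁻¹Δ, g⁻¹)`. -/
instance : Inv (ClosureMonoid c) where
  inv s :=
    { graph := s.elt⁻¹ • s.graph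
      elt := s.elt⁻¹
      compact := by
        obtain ⟨F, hF, hs⟩ := s.compact
        exact ⟨s.elt⁻¹ • F, hF.smul _, by rw [hs, c.map_smul]⟩
      one_mem := by
        rw [CayleySubgraph.mem_smul_verts, inv_inv, mul_one]; exact s.elt_mem
      elt_mem := by
        rw [CayleySubgraph.mem_smul_verts, inv_inv, mul_inv_cancel]; exact s.one_mem }

/-- `(Δ, g)^𝔪 = ({1, g}^c, g)`. -/
def maxi (s : ClosureMonoid c) : ClosureMonoid c where
  graph := c.op (CayleySubgraph.vertex ι 1 ⊔ CayleySubgraph.vertex ι s.elt)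
  elt := s.elt
  compact := ⟨_, CayleySubgraph.IsFinite.sup ⟨Set.finite_singleton _, Set.finite_empty⟩
    ⟨Set.finite_singleton _, Set.finite_empty⟩, rfl⟩
  one_mem := (c.op.le_closure _).1 (Or.inl rfl)
  elt_mem := (c.op.le_closure _).1 (Or.inr rfl)

end ClosureMonoid

/-! ## The presentation `FInv⟨X ∣ red(w) = w^𝔪, w ∈ (X ∪ X⁻¹)*⟩` -/

/-- The relations `red(w) = w^𝔪`, for all words `w` over `X ∪ X⁻¹`. -/
def redRel (X : Type u) (p q : ImTerm X) : Prop :=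
  ∃ w : InvWord X, p = ImTerm.ofWord (red w) ∧ q = ImTerm.maxWord w

theorem wordVal_freeGroup {X : Type u} (w : InvWord X) :
    wordVal FreeGroup.of w = FreeGroup.mk w := by
  induction w with
  | nil => rfl
  | cons a w ih =>
    rw [← List.singleton_append, ← FreeGroup.mul_mk, ← ih]
    rcases a with ⟨x, _ | _⟩ <;> simp [wordVal, letterVal, FreeGroup.of, FreeGroup.invRev]

/-- The two sides of each relation are equal in the free group. -/
theorem redRel_compatible {X : Type u} (p q : ImTerm X) (h : redRel X p q) :
    p.val id (FreeGroup.of : X → FreeGroup X) = q.val id FreeGroup.of := by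
  obtain ⟨w, rfl, rfl⟩ := h
  have h1 : (ImTerm.ofWord (red w)).val id (FreeGroup.of : X → FreeGroup X) =
      wordVal FreeGroup.of (red w) := by
    simp [ImTerm.val, ImTerm.ofWord, wordVal, Function.comp_def]
  have h2 : (ImTerm.maxWord w).val id (FreeGroup.of : X → FreeGroup X) =
      wordVal FreeGroup.of w := by
    simp [ImTerm.val, ImTerm.maxWord]
  rw [h1, h2, wordVal_freeGroup, wordVal_freeGroup]
  let := Classical.decEq X
  exact FreeGroup.reduce.self

/-- The closure operator `c_R` of the presentation, on the subgraphs of the Cayley graph of the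
free group on `X`. -/
def redClosure (X : Type u) : InvariantClosure (FreeGroup.of : X → FreeGroup X) :=
  relClosure FreeGroup.of (redRel X) redRel_compatible

end

/-!
In an inverse monoid, if `p` divides `s` on the left and `p ≤ r`, then `p⁻¹ s = r⁻¹ s`. The value of
a word `p` lies below the value of `red p`, so for a prefix `p` of `s` the element `p⁻¹ s` depends
only on the value of `p` in the free group. Hence whether a word `z` divides `s` can be read off
from the edges of the Cayley graph crossed by its path, and for words equal in the free group the
natural order is reverse inclusion of the subgraphs spanned by their paths. This is Munn's theorem:
a word is determined in the free inverse monoid by its subgraph and its value, and every finite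
connected subgraph is spanned by a path with prescribed ends.

For every invariant closure operator `c` the monoid `S_c` is F-inverse and two of its elements are
`σ`-related iff they have the same group component. The relations `red w = w^𝔪` require of a closed
subgraph that it contain the geodesic between any two of its vertices, which in a tree is
connectedness; so for them `S_c` is Munn's model. The greatest element of the `σ`-class of `w` in
the free inverse monoid is then `red w`, so the free inverse monoid satisfies the defining relations
of the presented monoid, and the homomorphisms given by the two universal properties are mutually
inverse.
-/

noncomputable section

open InverseMonoid FInverseMonoid CayleySubgraph

/-! ## Homomorphisms and divisibility in inverse monoids -/

namespace InverseMonoid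

variable {M N G F : Type*} [InverseMonoid M] [InverseMonoid N] [Group G] {a b c r s : M}

theorem NatLE.mul_inv_mul_eq (h : NatLE a b) : a * a⁻¹ * b = a := Eq.symm h

protected theorem map_inv [FunLike F M N] [MulHomClass F M N] (f : F) (a : M) :
    f a⁻¹ = (f a)⁻¹ := by
  obtain ⟨h₁, h₂⟩ := (eq_inv_iff a a⁻¹).2 rfl
  exact (eq_inv_iff _ _).1
    ⟨by rw [← map_mul, ← map_mul, h₁], by rw [← map_mul, ← map_mul, h₂]⟩

theorem NatLE.map [FunLike F M N] [MulHomClass F M N] (f : F) (h : NatLE a b) :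
    NatLE (f a) (f b) := by
  rw [NatLE, ← InverseMonoid.map_inv f, ← map_mul, ← map_mul, h.mul_inv_mul_eq]

theorem Sigma.map [FunLike F M N] [MulHomClass F M N] (f : F) (h : Sigma a b) :
    Sigma (f a) (f b) :=
  let ⟨_, ha, hb⟩ := h
  ⟨_, ha.map f, hb.map f⟩

theorem sigma_map_equiv_iff (e : M ≃* N) : Sigma (e a) (e b) ↔ Sigma a b :=
  ⟨fun h => by simpa only [MulEquiv.symm_apply_apply] using h.map e.symm, fun h => h.map e⟩

theorem IsSigmaGreatest.map_equiv (e : M ≃* N) {m : M} (h : IsSigmaGreatest s m) :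
    IsSigmaGreatest (e s) (e m) := by
  refine ⟨h.1.map e, e.surjective.forall.2 fun t ht => ?_⟩
  exact (h.2 t ((sigma_map_equiv_iff e).1 ht)).map e

theorem IsSigmaGreatest.unique {m m' : M} (h : IsSigmaGreatest s m) (h' : IsSigmaGreatest s m') :
    m = m' :=
  (h'.2 _ h.1).antisymm (h.2 _ h'.1)

theorem NatLE.map_eq (f : M →* G) (h : NatLE a b) : f a = f b := by
  have hidem : f (a * a⁻¹) = 1 := by
    rw [← mul_eq_left (a := f (a * a⁻¹)), ← map_mul, rr_idem]
  rw [← h.mul_inv_mul_eq, map_mul, hidem, one_mul]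

theorem Sigma.map_eq (f : M →* G) (h : Sigma a b) : f a = f b :=
  let ⟨_, ha, hb⟩ := h
  (ha.map_eq f).symm.trans (hb.map_eq f)

/-- The greatest group image of `M`, computed from a surjective homomorphism onto a group that
identifies only `σ`-related elements. -/
def groupImageEquiv (f : M →* G) (hf : Function.Surjective f)
    (hσ : ∀ a b, f a = f b → Sigma a b) : GroupImage M ≃* G :=
  MulEquiv.ofBijective ((sigmaCon M).lift f fun _ _ h => Sigma.map_eq f h)
    ⟨fun a b => Con.induction_on₂ a b fun a b h => (Con.eq _).2 (hσ a b h),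
      Con.lift_surjective_of_surjective _ hf⟩

theorem groupImageEquiv_sigmaMk (f : M →* G) (hf : Function.Surjective f)
    (hσ : ∀ a b, f a = f b → Sigma a b) (a : M) : groupImageEquiv f hf hσ (sigmaMk a) = f a :=
  rfl

theorem dvd_iff_mul_inv_mul_eq : a ∣ s ↔ a * a⁻¹ * s = s := by
  refine ⟨?_, fun h => ⟨a⁻¹ * s, by rw [← mul_assoc, h]⟩⟩
  rintro ⟨c, rfl⟩
  rw [← mul_assoc, mul_inv_mul']

theorem mul_dvd_iff_dvd_inv_mul : a * b ∣ s ↔ a ∣ s ∧ b ∣ a⁻¹ * s := by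
  constructor
  · rintro ⟨c, rfl⟩
    refine ⟨(dvd_mul_right a b).mul_right c, dvd_iff_mul_inv_mul_eq.2 ?_⟩
    have hcomm : b * b⁻¹ * (a⁻¹ * a) = a⁻¹ * a * (b * b⁻¹) := by
      simpa only [inv_inv] using comm_rr b a⁻¹
    calc b * b⁻¹ * (a⁻¹ * (a * b * c)) = b * b⁻¹ * (a⁻¹ * a) * b * c := by simp only [mul_assoc]
      _ = a⁻¹ * a * (b * b⁻¹ * b) * c := by rw [hcomm]; simp only [mul_assoc]
      _ = a⁻¹ * (a * b * c) := by rw [mul_inv_mul']; simp only [mul_assoc]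
  · rintro ⟨ha, c, hc⟩
    exact ⟨c, by rw [mul_assoc, ← hc, ← mul_assoc, dvd_iff_mul_inv_mul_eq.1 ha]⟩

theorem mul_mul_inv_dvd_mul (a b : M) : a * b * b⁻¹ ∣ a * b :=
  ⟨b, by rw [mul_assoc, mul_assoc, mul_inv_mul]⟩

theorem NatLE.inv_mul_eq (h : NatLE a r) (hs : a ∣ s) : a⁻¹ * s = r⁻¹ * s :=
  calc a⁻¹ * s = (a * a⁻¹ * r)⁻¹ * s := by rw [h.mul_inv_mul_eq]
    _ = r⁻¹ * (a * a⁻¹ * s) := by rw [mul_inv_r, rr_inv, mul_assoc]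
    _ = r⁻¹ * s := by rw [dvd_iff_mul_inv_mul_eq.1 hs]

theorem NatLE.mul_dvd_of_mul_dvd (ha : NatLE a r) (hb : NatLE b r) (has : a ∣ s)
    (hbs : b * c ∣ s) : a * c ∣ s := by
  rw [mul_dvd_iff_dvd_inv_mul] at hbs ⊢
  rw [ha.inv_mul_eq has, ← hb.inv_mul_eq hbs.1]
  exact ⟨has, hbs.2⟩

theorem NatLE.natLE_of_dvd (ha : NatLE a r) (hb : NatLE b r) (h : b ∣ a) : NatLE a b :=
  calc a = b * b⁻¹ * (a * a⁻¹ * r) := by rw [ha.mul_inv_mul_eq, dvd_iff_mul_inv_mul_eq.1 h]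
    _ = a * a⁻¹ * (b * b⁻¹ * r) := by rw [← mul_assoc, comm_rr, mul_assoc]
    _ = a * a⁻¹ * b := by rw [hb.mul_inv_mul_eq]

end InverseMonoid

namespace FInverseMonoid

variable {M N : Type*} [FInverseMonoid M] [FInverseMonoid N]

theorem sigma_iff_maxi_eq {a b : M} : Sigma a b ↔ maxi a = maxi b :=
  ⟨maxi_eq_of_sigma, fun h =>
    (isSigmaGreatest_maxi a).1.trans (h ▸ (isSigmaGreatest_maxi b).1.symm)⟩

theorem map_maxi (e : M ≃* N) (s : M) : e (maxi s) = maxi (e s) :=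
  ((isSigmaGreatest_maxi s).map_equiv e).unique (isSigmaGreatest_maxi (e s))

end FInverseMonoid

/-! ## Words and their values -/

section Words

variable {X M N G : Type*}

section Monoid

variable [Monoid M] [Inv M] [Monoid N] [Inv N] (ι : X → M)

theorem wordVal_nil : wordVal ι [] = 1 := rfl

theorem wordVal_append (w z : InvWord X) : wordVal ι (w ++ z) = wordVal ι w * wordVal ι z := by
  simp [wordVal]

theorem wordVal_cons (a : X × Bool) (w : InvWord X) :
    wordVal ι (a :: w) = letterVal ι a * wordVal ι w := by
  simp [wordVal]

theorem wordVal_singleton (a : X × Bool) : wordVal ι [a] = letterVal ι a := by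
  simp [wordVal]

theorem map_letterVal (f : M →* N) (hf : ∀ s, f s⁻¹ = (f s)⁻¹) (a : X × Bool) :
    f (letterVal ι a) = letterVal (f ∘ ι) a := by
  rcases a with ⟨x, _ | _⟩ <;> simp [letterVal, hf]

theorem map_wordVal (f : M →* N) (hf : ∀ s, f s⁻¹ = (f s)⁻¹) (w : InvWord X) :
    f (wordVal ι w) = wordVal (f ∘ ι) w := by
  simp [wordVal, map_list_prod, Function.comp_def, map_letterVal ι f hf]

theorem ImTerm.val_ofWord (m : M → M) (w : InvWord X) :
    (ImTerm.ofWord w).val m ι = wordVal ι w := by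
  simp [ImTerm.val, ImTerm.ofWord, wordVal, Function.comp_def]

theorem ImTerm.val_maxWord (m : M → M) (w : InvWord X) :
    (ImTerm.maxWord w).val m ι = m (wordVal ι w) := by
  simp [ImTerm.val, ImTerm.maxWord]

theorem ImTerm.map_val (f : M →* N) (hf : ∀ s, f s⁻¹ = (f s)⁻¹) {m : M → M} {m' : N → N}
    (hm : ∀ s, f (m s) = m' (f s)) (p : ImTerm X) : f (p.val m ι) = p.val m' (f ∘ ι) := by
  rw [ImTerm.val, ImTerm.val, map_list_prod, List.map_map]
  congr 2
  funext a
  rcases a with a | v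
  · exact map_letterVal ι f hf a
  · exact (hm _).trans (congrArg m' (map_wordVal ι f hf v))

end Monoid

theorem invRev_cons (a : X × Bool) (w : InvWord X) :
    FreeGroup.invRev (a :: w) = FreeGroup.invRev w ++ [letterInv a] := by
  simp [FreeGroup.invRev, letterInv]

theorem letterInv_letterInv (a : X × Bool) : letterInv (letterInv a) = a := by
  simp [letterInv]

theorem red_eq_red_iff {w z : InvWord X} : red w = red z ↔ FreeGroup.mk w = FreeGroup.mk z :=
  letI := Classical.decEq X
  ⟨FreeGroup.reduce.exact, FreeGroup.reduce.sound⟩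

theorem mk_red (w : InvWord X) : FreeGroup.mk (red w) = FreeGroup.mk w :=
  letI := Classical.decEq X
  FreeGroup.reduce.self

theorem freeGroupRed_red (w : InvWord X) : FreeGroup.Red w (red w) :=
  letI := Classical.decEq X
  FreeGroup.reduce.red

theorem wordVal_eq_lift [Group G] (κ : X → G) (w : InvWord X) :
    wordVal κ w = FreeGroup.lift κ (FreeGroup.mk w) := by
  simp only [wordVal, FreeGroup.lift_mk, Bool.cond_eq_ite]
  rfl

theorem group_wordVal_red [Group G] (κ : X → G) (w : InvWord X) :
    wordVal κ (red w) = wordVal κ w := by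
  rw [wordVal_eq_lift, wordVal_eq_lift, mk_red]

theorem group_wordVal_invRev [Group G] (κ : X → G) (w : InvWord X) :
    wordVal κ (FreeGroup.invRev w) = (wordVal κ w)⁻¹ := by
  rw [wordVal_eq_lift, ← FreeGroup.inv_mk, map_inv, ← wordVal_eq_lift]

theorem group_wordVal_append_invRev [Group G] (κ : X → G) (w : InvWord X) :
    wordVal κ (w ++ FreeGroup.invRev w) = 1 := by
  rw [wordVal_append, group_wordVal_invRev, mul_inv_cancel]

section InverseMonoid

variable [InverseMonoid M] (ι : X → M)

theorem letterVal_letterInv_eq_inv (a : X × Bool) :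
    letterVal ι (letterInv a) = (letterVal ι a)⁻¹ := by
  rcases a with ⟨x, _ | _⟩ <;> simp [letterVal, letterInv]

theorem wordVal_invRev (w : InvWord X) : wordVal ι (FreeGroup.invRev w) = (wordVal ι w)⁻¹ := by
  induction w with
  | nil => exact inv_one'.symm
  | cons a w ih =>
    rw [invRev_cons, wordVal_append, ih, wordVal_singleton, letterVal_letterInv_eq_inv,
      wordVal_cons, mul_inv_r]

theorem wordVal_natLE_of_step {w z : InvWord X} (h : FreeGroup.Red.Step w z) :
    NatLE (wordVal ι w) (wordVal ι z) := by
  rcases h with @⟨u, v, x, b⟩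
  have hword : wordVal ι (u ++ (x, b) :: (x, !b) :: v) =
      wordVal ι u * (letterVal ι (x, b) * (letterVal ι (x, b))⁻¹) * wordVal ι v := by
    rw [← letterVal_letterInv_eq_inv]
    simp only [wordVal_append, wordVal_cons, mul_assoc, letterInv]
  rw [hword, wordVal_append]
  exact (mul_idem_le _ (rr_idem _)).mul (NatLE.refl _)

theorem wordVal_natLE_of_red {w z : InvWord X} (h : FreeGroup.Red w z) :
    NatLE (wordVal ι w) (wordVal ι z) := by
  induction h with
  | refl => exact NatLE.refl _
  | tail _ hstep ih => exact ih.trans (wordVal_natLE_of_step ι hstep)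

theorem wordVal_natLE_wordVal_red (w : InvWord X) : NatLE (wordVal ι w) (wordVal ι (red w)) :=
  wordVal_natLE_of_red ι (freeGroupRed_red w)

end InverseMonoid

end Words

/-! ## Subgraphs of Cayley graphs -/

namespace CayleySubgraph

variable {X G : Type*} [Group G] {ι : X → G} {Δ Ξ F : CayleySubgraph ι}

theorem vertex_le_iff {g : G} : vertex ι g ≤ Δ ↔ g ∈ Δ.verts :=
  ⟨fun h => h.1 rfl, fun h => ⟨Set.singleton_subset_iff.2 h, Set.empty_subset _⟩⟩

theorem edge_le_iff {g : G} {a : X × Bool} : edge ι g a ≤ Δ ↔ (g, a) ∈ Δ.edges :=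
  ⟨fun h => h.2 (Or.inl rfl), fun h =>
    ⟨Set.pair_subset (Δ.source_mem g a h) (Δ.target_mem g a h),
      Set.pair_subset h (Δ.inv_mem g a h)⟩⟩

theorem smul_le_iff {k : G} : k • Δ ≤ Ξ ↔ Δ ≤ k⁻¹ • Ξ :=
  ⟨fun h => by simpa only [inv_smul_smul] using smul_mono (g := k⁻¹) h,
    fun h => by simpa only [smul_inv_smul] using smul_mono (g := k) h⟩

theorem smul_vertex (k g : G) : k • vertex ι g = vertex ι (k * g) :=
  eq_of_forall_ge_iff fun Δ => by
    rw [smul_le_iff, vertex_le_iff, vertex_le_iff, mem_smul_verts, inv_inv]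

theorem smul_edge (k g : G) (a : X × Bool) : k • edge ι g a = edge ι (k * g) a :=
  eq_of_forall_ge_iff fun Δ => by
    rw [smul_le_iff, edge_le_iff, edge_le_iff, mem_smul_edges, inv_inv]

theorem edge_letterInv (g : G) (a : X × Bool) :
    edge ι (g * letterVal ι a) (letterInv a) = edge ι g a := by
  refine eq_of_forall_ge_iff fun Δ => ?_
  rw [edge_le_iff, edge_le_iff]
  refine ⟨fun h => ?_, Δ.inv_mem g a⟩
  simpa only [letterVal_letterInv, mul_inv_cancel_right, letterInv_letterInv] using Δ.inv_mem _ _ h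

theorem labelsPath_iff {w : InvWord X} {g h : G} :
    Δ.LabelsPath w g h ↔ pathSpan ι g w ≤ Δ ∧ g * wordVal ι w = h := by
  induction w generalizing g with
  | nil => rw [LabelsPath, pathSpan, vertex_le_iff, wordVal_nil, mul_one]
  | cons a w ih =>
    rw [LabelsPath, pathSpan, sup_le_iff, edge_le_iff, ih, wordVal_cons, mul_assoc, and_assoc]

theorem source_mem_pathSpan (g : G) (w : InvWord X) : g ∈ (pathSpan ι g w).verts := by
  cases w with
  | nil => rfl
  | cons a w => exact Or.inl (Or.inl rfl)

theorem pathSpan_append (g : G) (w z : InvWord X) :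
    pathSpan ι g (w ++ z) = pathSpan ι g w ⊔ pathSpan ι (g * wordVal ι w) z := by
  induction w generalizing g with
  | nil =>
    rw [List.nil_append, wordVal_nil, mul_one, pathSpan, right_eq_sup, vertex_le_iff]
    exact source_mem_pathSpan g z
  | cons a w ih => rw [List.cons_append, pathSpan, pathSpan, ih, wordVal_cons, mul_assoc, sup_assoc]

theorem target_mem_pathSpan (g : G) (w : InvWord X) :
    g * wordVal ι w ∈ (pathSpan ι g w).verts := by
  have h := pathSpan_append (ι := ι) g w []
  rw [List.append_nil] at h
  exact h ▸ Or.inr rfl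

theorem pathSpan_singleton (g : G) (a : X × Bool) : pathSpan ι g [a] = edge ι g a :=
  sup_eq_left.2 (vertex_le_iff.2 (Or.inr rfl))

theorem pathSpan_append_invRev (g : G) (w : InvWord X) :
    pathSpan ι g (w ++ FreeGroup.invRev w) = pathSpan ι g w := by
  induction w generalizing g with
  | nil => rfl
  | cons a w ih =>
    have hback : g * letterVal ι a * wordVal ι (w ++ FreeGroup.invRev w) = g * letterVal ι a := by
      rw [group_wordVal_append_invRev, mul_one]
    rw [invRev_cons, List.cons_append, ← List.append_assoc, pathSpan, pathSpan_append, ih, hback,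
      pathSpan_singleton, edge_letterInv, pathSpan, sup_comm (pathSpan _ _ _),
      sup_left_idem]

theorem smul_pathSpan (k g : G) (w : InvWord X) : k • pathSpan ι g w = pathSpan ι (k * g) w := by
  induction w generalizing g with
  | nil => exact smul_vertex k g
  | cons a w ih => rw [pathSpan, pathSpan, smul_sup, smul_edge, ih, mul_assoc]

theorem pathSpan_le_of_red {w z : InvWord X} (h : FreeGroup.Red w z) (g : G) :
    pathSpan ι g z ≤ pathSpan ι g w := by
  induction h with
  | refl => exact le_rfl
  | @tail _ _ _ hstep ih =>
    refine le_trans ?_ ih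
    rcases hstep with @⟨u, v, x, b⟩
    have hloop : (g * wordVal ι u) * wordVal ι [(x, b), (x, !b)] = g * wordVal ι u := by
      rw [show [(x, b), (x, !b)] = [(x, b)] ++ FreeGroup.invRev [(x, b)] from rfl,
        group_wordVal_append_invRev, mul_one]
    rw [pathSpan_append, show (x, b) :: (x, !b) :: v = [(x, b), (x, !b)] ++ v from rfl,
      pathSpan_append _ u, pathSpan_append _ _ v, hloop]
    exact sup_le_sup_left le_sup_right _

theorem IsFinite.mono (hΞ : Ξ.IsFinite) (h : Δ ≤ Ξ) : Δ.IsFinite :=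
  ⟨hΞ.1.subset h.1, hΞ.2.subset h.2⟩

theorem vertex_isFinite (g : G) : (vertex ι g).IsFinite :=
  ⟨Set.finite_singleton _, Set.finite_empty⟩

theorem edge_isFinite (g : G) (a : X × Bool) : (edge ι g a).IsFinite :=
  ⟨(Set.finite_singleton _).insert _, (Set.finite_singleton _).insert _⟩

theorem pathSpan_isFinite (g : G) (w : InvWord X) : (pathSpan ι g w).IsFinite := by
  induction w generalizing g with
  | nil => exact vertex_isFinite g
  | cons a w ih => exact (edge_isFinite g a).sup (ih _)

@[elab_as_elim]
theorem IsFinite.induction_on {P : CayleySubgraph ι → Prop} (hΔ : Δ.IsFinite) (bot : P ⊥)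
    (sup : ∀ Ξ, P Ξ → ∀ Ξ', P Ξ' → P (Ξ ⊔ Ξ')) (vertex : ∀ g ∈ Δ.verts, P (vertex ι g))
    (edge : ∀ g a, (g, a) ∈ Δ.edges → P (edge ι g a)) : P Δ := by
  have hsup : Δ = hΔ.1.toFinset.sup (CayleySubgraph.vertex ι) ⊔
      hΔ.2.toFinset.sup fun e => CayleySubgraph.edge ι e.1 e.2 := by
    refine eq_of_forall_ge_iff fun Ξ => ?_
    simp only [sup_le_iff, Finset.sup_le_iff, vertex_le_iff, edge_le_iff, Set.Finite.mem_toFinset]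
    rfl
  rw [hsup]
  exact sup _
    (Finset.sup_induction bot sup fun g hg => vertex g (hΔ.1.mem_toFinset.1 hg)) _
    (Finset.sup_induction bot sup fun e he => edge e.1 e.2 (hΔ.2.mem_toFinset.1 he))

theorem connected_iff :
    Δ.Connected ↔ ∀ g ∈ Δ.verts, ∀ h ∈ Δ.verts,
      ∃ w, pathSpan ι g w ≤ Δ ∧ g * wordVal ι w = h := by
  simp only [Connected, labelsPath_iff]

theorem Connected.exists_closed_path (hΔ : Δ.Connected) {r : G} (hr : r ∈ Δ.verts)
    (hF : F.IsFinite) (hle : F ≤ Δ) :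
    ∃ w, F ≤ pathSpan ι r w ∧ pathSpan ι r w ≤ Δ ∧ wordVal ι w = 1 := by
  refine hF.induction_on ⟨[], bot_le, vertex_le_iff.2 hr, wordVal_nil ι⟩ ?_ ?_ ?_
  · rintro Ξ ⟨w, hw, hwΔ, hw1⟩ Ξ' ⟨z, hz, hzΔ, hz1⟩
    refine ⟨w ++ z, ?_, ?_, ?_⟩ <;> simp only [pathSpan_append, wordVal_append, hw1, hz1, mul_one]
    · exact sup_le_sup hw hz
    · exact sup_le hwΔ hzΔ
  · intro g hg
    obtain ⟨p, hp, rfl⟩ := connected_iff.1 hΔ r hr g (hle.1 hg)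
    refine ⟨p ++ FreeGroup.invRev p, ?_, ?_, group_wordVal_append_invRev ι p⟩ <;>
      rw [pathSpan_append_invRev]
    · exact vertex_le_iff.2 (target_mem_pathSpan r p)
    · exact hp
  · intro g a ha
    obtain ⟨p, hp, rfl⟩ := connected_iff.1 hΔ r hr g (Δ.source_mem g a (hle.2 ha))
    refine ⟨p ++ [a] ++ FreeGroup.invRev (p ++ [a]), ?_, ?_, group_wordVal_append_invRev ι _⟩ <;>
      rw [pathSpan_append_invRev, pathSpan_append, pathSpan_singleton]
    · exact le_sup_right
    · exact sup_le hp (edge_le_iff.2 (hle.2 ha))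

theorem Connected.exists_pathSpan_eq (hΔ : Δ.Connected) (hfin : Δ.IsFinite) {g h : G}
    (hg : g ∈ Δ.verts) (hh : h ∈ Δ.verts) : ∃ w, pathSpan ι g w = Δ ∧ g * wordVal ι w = h := by
  obtain ⟨w, hw, hwΔ, hw1⟩ := hΔ.exists_closed_path hg hfin le_rfl
  obtain ⟨p, hp, hph⟩ := connected_iff.1 hΔ g hg h hh
  have hspan : pathSpan ι g w = Δ := hwΔ.antisymm hw
  refine ⟨w ++ p, ?_, by rw [wordVal_append, hw1, one_mul, hph]⟩
  rw [pathSpan_append, hw1, mul_one, hspan, sup_eq_left.2 hp]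

theorem connected_of_root {r : G}
    (h : ∀ g ∈ Δ.verts, ∃ w, pathSpan ι r w ≤ Δ ∧ r * wordVal ι w = g) : Δ.Connected := by
  refine connected_iff.2 fun g hg k hk => ?_
  obtain ⟨w, hw, rfl⟩ := h g hg
  obtain ⟨z, hz, rfl⟩ := h k hk
  refine ⟨FreeGroup.invRev w ++ z, ?_, ?_⟩
  · have hwinv : pathSpan ι (r * wordVal ι w) (FreeGroup.invRev w) ≤ Δ := by
      refine le_trans ?_ hw
      rw [← pathSpan_append_invRev r w, pathSpan_append]
      exact le_sup_right
    rw [pathSpan_append, group_wordVal_invRev, mul_inv_cancel_right]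
    exact sup_le hwinv hz
  · rw [wordVal_append, group_wordVal_invRev, mul_assoc, mul_inv_cancel_left]

theorem pathSpan_connected (g : G) (w : InvWord X) : (pathSpan ι g w).Connected := by
  refine connected_of_root (r := g) fun h hh => ?_
  induction w generalizing g with
  | nil => exact ⟨[], le_rfl, by rw [wordVal_nil, mul_one]; exact (Set.mem_singleton_iff.1 hh).symm⟩
  | cons a w ih =>
    rcases hh with (rfl | rfl) | hh
    · exact ⟨[], vertex_le_iff.2 (source_mem_pathSpan h _), by rw [wordVal_nil, mul_one]⟩
    · exact ⟨[a], (pathSpan_singleton g a).trans_le le_sup_left, by rw [wordVal_singleton]⟩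
    · obtain ⟨z, hz, rfl⟩ := ih _ hh
      exact ⟨a :: z, sup_le_sup_left hz _, by rw [wordVal_cons, mul_assoc]⟩

theorem Connected.smul (hΔ : Δ.Connected) (k : G) : (k • Δ).Connected := by
  refine connected_iff.2 fun g hg h hh => ?_
  obtain ⟨w, hw, hgh⟩ := connected_iff.1 hΔ _ hg _ hh
  refine ⟨w, ?_, by rwa [mul_assoc, mul_right_inj] at hgh⟩
  simpa only [smul_pathSpan, mul_inv_cancel_left] using smul_mono (g := k) hw

theorem Connected.sup (hΔ : Δ.Connected) (hΞ : Ξ.Connected) {r : G} (hr : r ∈ Δ.verts)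
    (hr' : r ∈ Ξ.verts) : (Δ ⊔ Ξ).Connected := by
  refine connected_of_root (r := r) fun g hg => ?_
  rcases hg with hg | hg
  · obtain ⟨w, hw, h⟩ := connected_iff.1 hΔ r hr g hg
    exact ⟨w, hw.trans le_sup_left, h⟩
  · obtain ⟨w, hw, h⟩ := connected_iff.1 hΞ r hr' g hg
    exact ⟨w, hw.trans le_sup_right, h⟩

theorem labelsJourney_ofWord {w : InvWord X} {g h : G} :
    Δ.LabelsJourney (ImTerm.ofWord w) g h ↔ pathSpan ι g w ≤ Δ ∧ g * wordVal ι w = h := by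
  rw [← labelsPath_iff]
  induction w generalizing g with
  | nil => rfl
  | cons a w ih => exact and_congr_right fun _ => ih

theorem labelsJourney_maxWord {w : InvWord X} {g h : G} :
    Δ.LabelsJourney (ImTerm.maxWord w) g h ↔
      g ∈ Δ.verts ∧ g * wordVal ι w ∈ Δ.verts ∧ g * wordVal ι w = h :=
  Iff.rfl

end CayleySubgraph

/-! ## The natural order on words -/

section DivisorGraph

variable {X M : Type*} [InverseMonoid M] (ι : X → M)

/-- The subgraph of the Cayley graph of the free group traced by the words whose values in `M` are
prefixes of `s`; it plays the role of the Schützenberger graph of `s`. -/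
def divisorGraph (s : M) : CayleySubgraph (FreeGroup.of : X → FreeGroup X) where
  verts := {g | ∃ p, FreeGroup.mk p = g ∧ wordVal ι p ∣ s}
  edges := {e | ∃ p, FreeGroup.mk p = e.1 ∧ wordVal ι (p ++ [e.2]) ∣ s}
  source_mem := by
    rintro _ a ⟨p, rfl, h⟩
    exact ⟨p, rfl, dvd_of_mul_right_dvd (wordVal_append ι p [a] ▸ h)⟩
  target_mem := by
    rintro _ a ⟨p, rfl, h⟩
    refine ⟨p ++ [a], ?_, h⟩
    rw [← wordVal_freeGroup, wordVal_append, wordVal_freeGroup, wordVal_singleton]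
  inv_mem := by
    rintro _ a ⟨p, rfl, h⟩
    refine ⟨p ++ [a], ?_, dvd_trans ?_ h⟩
    · rw [← wordVal_freeGroup, wordVal_append, wordVal_freeGroup, wordVal_singleton]
    · simp only [wordVal_append, wordVal_singleton, letterVal_letterInv_eq_inv]
      exact mul_mul_inv_dvd_mul _ _

-- A prefix `p` of `s` lies below `red p`, so `p⁻¹ s = (red p)⁻¹ s` depends only on the value of
-- `p` in the free group; hence edges read off from different prefixes fit together.
theorem wordVal_dvd_iff {w : InvWord X} {s : M} :
    wordVal ι w ∣ s ↔ pathSpan FreeGroup.of 1 w ≤ divisorGraph ι s := by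
  induction w using List.reverseRecOn with
  | nil =>
    exact iff_of_true (one_dvd s) (vertex_le_iff.2 ⟨[], rfl, one_dvd s⟩)
  | append_singleton w a ih =>
    rw [pathSpan_append, sup_le_iff, ← ih, pathSpan_singleton, edge_le_iff, one_mul,
      wordVal_freeGroup]
    refine ⟨fun h => ⟨dvd_of_mul_right_dvd (wordVal_append ι w [a] ▸ h), w, rfl, h⟩, ?_⟩
    rintro ⟨hw, p, hpw, hp⟩
    have hle : NatLE (wordVal ι p) (wordVal ι (red w)) :=
      red_eq_red_iff.2 hpw ▸ wordVal_natLE_wordVal_red ι p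
    rw [wordVal_append] at hp ⊢
    exact (wordVal_natLE_wordVal_red ι w).mul_dvd_of_mul_dvd hle hw hp

theorem wordVal_natLE_of_pathSpan_le {w z : InvWord X} (h : FreeGroup.mk w = FreeGroup.mk z)
    (hle : pathSpan (FreeGroup.of : X → FreeGroup X) 1 z ≤ pathSpan FreeGroup.of 1 w) :
    NatLE (wordVal ι w) (wordVal ι z) := by
  have hz : NatLE (wordVal ι z) (wordVal ι (red w)) :=
    red_eq_red_iff.2 h ▸ wordVal_natLE_wordVal_red ι z
  refine (wordVal_natLE_wordVal_red ι w).natLE_of_dvd hz ?_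
  exact (wordVal_dvd_iff ι).2 (hle.trans ((wordVal_dvd_iff ι).1 dvd_rfl))

end DivisorGraph

/-! ## The F-inverse monoid of an invariant closure operator -/

namespace ClosureMonoid

variable {X G : Type*} [Group G] {ι : X → G} {c : InvariantClosure ι}

theorem op_graph (s : ClosureMonoid c) : c.op s.graph = s.graph := by
  obtain ⟨F, -, hF⟩ := s.compact
  rw [hF, c.op.idempotent]

theorem vertex_one_le_graph (s : ClosureMonoid c) : vertex ι 1 ≤ s.graph :=
  vertex_le_iff.2 s.one_mem

theorem vertex_elt_le_graph (s : ClosureMonoid c) : vertex ι s.elt ≤ s.graph :=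
  vertex_le_iff.2 s.elt_mem

theorem graph_one : (1 : ClosureMonoid c).graph = c.op (vertex ι 1) := rfl

theorem elt_one : (1 : ClosureMonoid c).elt = 1 := rfl

theorem graph_mul (s t : ClosureMonoid c) :
    (s * t).graph = c.op (s.graph ⊔ s.elt • t.graph) := rfl

theorem elt_mul (s t : ClosureMonoid c) : (s * t).elt = s.elt * t.elt := rfl

theorem graph_inv (s : ClosureMonoid c) : s⁻¹.graph = s.elt⁻¹ • s.graph := rfl

theorem elt_inv (s : ClosureMonoid c) : s⁻¹.elt = s.elt⁻¹ := rfl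

theorem graph_mul_inv_self (s : ClosureMonoid c) : (s * s⁻¹).graph = s.graph := by
  rw [graph_mul, graph_inv, smul_inv_smul, sup_idem, op_graph]

theorem elt_mul_inv_self (s : ClosureMonoid c) : (s * s⁻¹).elt = 1 := mul_inv_cancel s.elt

instance : InverseMonoid (ClosureMonoid c) where
  mul_assoc s t u := ClosureMonoid.ext (by
    simp only [graph_mul, elt_mul, ← c.map_smul, ClosureOperator.closure_sup_closure_left,
      ClosureOperator.closure_sup_closure_right, smul_sup, mul_smul, sup_assoc])
    (mul_assoc s.elt t.elt u.elt)
  one_mul s := ClosureMonoid.ext (by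
    rw [graph_mul, graph_one, elt_one, one_smul, ClosureOperator.closure_sup_closure_left,
      sup_eq_right.2 s.vertex_one_le_graph, op_graph]) (one_mul s.elt)
  mul_one s := ClosureMonoid.ext (by
    rw [graph_mul, graph_one, ← c.map_smul, ClosureOperator.closure_sup_closure_right,
      smul_vertex, mul_one, sup_eq_left.2 s.vertex_elt_le_graph, op_graph]) (mul_one s.elt)
  inv_inv s := ClosureMonoid.ext (by rw [graph_inv, graph_inv, elt_inv, inv_inv, smul_inv_smul])
    (inv_inv s.elt)
  mul_inv_rev' s t := ClosureMonoid.ext (by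
    simp only [graph_mul, graph_inv, elt_mul, elt_inv, ← c.map_smul, smul_sup, mul_inv_rev,
      mul_smul, inv_smul_smul, sup_comm]) (mul_inv_rev s.elt t.elt)
  mul_inv_mul' s := ClosureMonoid.ext (by
    rw [graph_mul, graph_mul_inv_self, elt_mul_inv_self, one_smul, sup_idem, op_graph])
    (by rw [elt_mul, elt_mul_inv_self, one_mul])
  idem_comm' s t := ClosureMonoid.ext (by
    simp only [graph_mul (_ * _), graph_mul_inv_self, elt_mul_inv_self, one_smul, sup_comm])
    (by simp only [elt_mul (_ * _), elt_mul_inv_self])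

instance : FInverseMonoid (ClosureMonoid c) :=
  FInverseMonoid.ofEquations ClosureMonoid.maxi
    (fun s => ClosureMonoid.ext (by
      have hle : vertex ι 1 ⊔ vertex ι s.elt ≤ s.graph :=
        sup_le s.vertex_one_le_graph s.vertex_elt_le_graph
      rw [graph_mul, graph_mul_inv_self, elt_mul_inv_self, one_smul, ClosureMonoid.maxi,
        ClosureOperator.closure_sup_closure_right, sup_eq_left.2 hle, op_graph])
      (by rw [elt_mul, elt_mul_inv_self, one_mul, ClosureMonoid.maxi]))
    (fun s t => by
      have helt : (t * t⁻¹ * s).elt = s.elt := by rw [elt_mul, elt_mul_inv_self, one_mul]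
      ext1 <;> simp only [ClosureMonoid.maxi, helt])

variable (c) in
/-- The projection of `S_c` onto `G`; its kernel is `σ`, so that `G` is the greatest group image
of `S_c`. -/
def eltHom : ClosureMonoid c →* G where
  toFun := elt
  map_one' := rfl
  map_mul' _ _ := rfl

theorem sigma_iff_elt_eq {s t : ClosureMonoid c} : Sigma s t ↔ s.elt = t.elt := by
  refine ⟨Sigma.map_eq (eltHom c), fun h => sigma_iff_maxi_eq.2 ?_⟩
  exact ClosureMonoid.ext (by simp only [FInverseMonoid.maxi, maxi, h]) h

theorem eltHom_surjective : Function.Surjective (eltHom c) := fun g =>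
  ⟨⟨c.op (vertex ι 1 ⊔ vertex ι g), g, ⟨_, (vertex_isFinite 1).sup (vertex_isFinite g), rfl⟩,
    (c.op.le_closure _).1 (Or.inl rfl), (c.op.le_closure _).1 (Or.inr rfl)⟩, rfl⟩

variable (c) in
/-- The canonical generators `(⟨x⟩^c, x)` of `S_c`. -/
def of (x : X) : ClosureMonoid c where
  graph := c.op (edge ι 1 (x, true))
  elt := ι x
  compact := ⟨_, edge_isFinite 1 (x, true), rfl⟩
  one_mem := (c.op.le_closure _).1 (Or.inl rfl)
  elt_mem := (c.op.le_closure _).1 (Or.inr (one_mul (ι x)).symm)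

theorem elt_letterVal_of (a : X × Bool) : (letterVal (of c) a).elt = letterVal ι a :=
  map_letterVal (of c) (eltHom c) (fun _ => rfl) a

theorem elt_wordVal_of (w : InvWord X) : (wordVal (of c) w).elt = wordVal ι w :=
  map_wordVal (of c) (eltHom c) (fun _ => rfl) w

theorem graph_letterVal_of (a : X × Bool) :
    (letterVal (of c) a).graph = c.op (edge ι 1 a) := by
  rcases a with ⟨x, _ | _⟩
  · have hedge : edge ι (ι x)⁻¹ (x, true) = edge ι 1 (x, false) := by
      rw [← edge_letterInv]
      exact congrArg (edge ι · (x, false)) (inv_mul_cancel (ι x))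
    change (ι x)⁻¹ • c.op (edge ι 1 (x, true)) = _
    rw [← c.map_smul, smul_edge, mul_one, hedge]
  · rfl

theorem graph_wordVal_of (w : InvWord X) :
    (wordVal (of c) w).graph = c.op (pathSpan ι 1 w) := by
  induction w with
  | nil => rfl
  | cons a w ih =>
    rw [wordVal_cons, graph_mul, ih, graph_letterVal_of, elt_letterVal_of, ← c.map_smul,
      ClosureOperator.closure_sup_closure, smul_pathSpan, mul_one, pathSpan, one_mul]

end ClosureMonoid

/-! ## The closure operator of the relations `red(w) = w^𝔪` -/

section RedClosure

variable {X : Type*} {Δ : CayleySubgraph (FreeGroup.of : X → FreeGroup X)}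

theorem CayleySubgraph.Connected.pathSpan_red_le (hΔ : Δ.Connected) {g : FreeGroup X}
    {w : InvWord X} (hg : g ∈ Δ.verts) (hgw : g * wordVal FreeGroup.of w ∈ Δ.verts) :
    pathSpan FreeGroup.of g (red w) ≤ Δ := by
  obtain ⟨z, hz, hzw⟩ := connected_iff.1 hΔ g hg _ hgw
  rw [mul_right_inj, wordVal_freeGroup, wordVal_freeGroup] at hzw
  rw [← red_eq_red_iff.2 hzw]
  exact (pathSpan_le_of_red (freeGroupRed_red z) g).trans hz

theorem redClosure_isClosed_iff : (redClosure X).op.IsClosed Δ ↔ Δ.Connected := by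
  change Δ.RelClosed (redRel X) ↔ _
  constructor
  · refine fun h => connected_iff.2 fun g hg k hk => ?_
    obtain ⟨w, rfl⟩ : ∃ w, g * wordVal FreeGroup.of w = k := by
      obtain ⟨w, hw⟩ := Quot.exists_rep (g⁻¹ * k)
      exact ⟨w, by rw [wordVal_freeGroup]; exact mul_eq_of_eq_inv_mul hw⟩
    have hjump := (h _ _ ⟨w, rfl, rfl⟩ g hg _ hk).2 (labelsJourney_maxWord.2 ⟨hg, hk, rfl⟩)
    exact ⟨red w, labelsJourney_ofWord.1 hjump⟩
  · rintro h _ _ ⟨w, rfl, rfl⟩ g hg k hk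
    rw [labelsJourney_ofWord, labelsJourney_maxWord, group_wordVal_red]
    refine ⟨fun ⟨_, hgk⟩ => ⟨hg, hgk ▸ hk, hgk⟩, fun ⟨_, hgw, hgk⟩ => ⟨?_, hgk⟩⟩
    exact h.pathSpan_red_le hg hgw

theorem redClosure_op_eq (hΔ : Δ.Connected) : (redClosure X).op Δ = Δ :=
  (redClosure_isClosed_iff.2 hΔ).closure_eq

theorem top_connected : (⊤ : CayleySubgraph (FreeGroup.of : X → FreeGroup X)).Connected :=
  redClosure_isClosed_iff.1 (redClosure X).op.isClosed_top

theorem isCompactSubgraph_redClosure_iff :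
    IsCompactSubgraph (redClosure X) Δ ↔ Δ.IsFinite ∧ Δ.Connected := by
  constructor
  · rintro ⟨F, hF, rfl⟩
    obtain ⟨w, hFw, -, -⟩ := top_connected.exists_closed_path (Set.mem_univ 1) hF le_top
    have hle := (redClosure X).op.closure_min hFw
      (redClosure_isClosed_iff.2 (pathSpan_connected 1 w))
    exact ⟨(pathSpan_isFinite 1 w).mono hle,
      redClosure_isClosed_iff.1 ((redClosure X).op.isClosed_closure F)⟩
  · exact fun ⟨hfin, hconn⟩ => ⟨Δ, hfin, (redClosure_op_eq hconn).symm⟩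

namespace ClosureMonoid

theorem connected_graph (s : ClosureMonoid (redClosure X)) : s.graph.Connected :=
  (isCompactSubgraph_redClosure_iff.1 s.compact).2

theorem exists_graph_eq_elt_eq_iff {g : FreeGroup X} :
    (∃ s : ClosureMonoid (redClosure X), s.graph = Δ ∧ s.elt = g) ↔
      Δ.IsFinite ∧ Δ.Connected ∧ 1 ∈ Δ.verts ∧ g ∈ Δ.verts := by
  rw [← and_assoc, ← isCompactSubgraph_redClosure_iff]
  constructor
  · rintro ⟨s, rfl, rfl⟩
    exact ⟨s.compact, s.one_mem, s.elt_mem⟩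
  · exact fun ⟨hΔ, h1, hg⟩ => ⟨⟨Δ, g, hΔ, h1, hg⟩, rfl, rfl⟩

theorem graph_mul_redClosure (s t : ClosureMonoid (redClosure X)) :
    (s * t).graph = s.graph ⊔ s.elt • t.graph := by
  refine redClosure_op_eq (s.connected_graph.sup (t.connected_graph.smul s.elt) s.elt_mem ?_)
  rw [mem_smul_verts, inv_mul_cancel]
  exact t.one_mem

theorem graph_wordVal_of_redClosure (w : InvWord X) :
    (wordVal (of (redClosure X)) w).graph = pathSpan FreeGroup.of 1 w := by
  rw [graph_wordVal_of, redClosure_op_eq (pathSpan_connected 1 w)]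

theorem exists_wordVal_of_eq (s : ClosureMonoid (redClosure X)) :
    ∃ w, wordVal (of (redClosure X)) w = s := by
  obtain ⟨hfin, hconn⟩ := isCompactSubgraph_redClosure_iff.1 s.compact
  obtain ⟨w, hw, hs⟩ := hconn.exists_pathSpan_eq hfin s.one_mem s.elt_mem
  refine ⟨w, ClosureMonoid.ext ?_ ?_⟩
  · rw [graph_wordVal_of_redClosure, hw]
  · rw [elt_wordVal_of, ← hs, one_mul]

end ClosureMonoid

end RedClosure

/-! ## Munn's theorem -/

namespace FreeInverseMonoid

variable {X M : Type*} [InverseMonoid M]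

theorem wordVal_of (w : InvWord X) : wordVal of w = mk w := by
  induction w with
  | nil => rfl
  | cons a w ih =>
    rw [wordVal_cons, ih]
    rcases a with ⟨x, _ | _⟩ <;> rfl

/-- The homomorphism from the free inverse monoid extending `ι`. -/
def lift (ι : X → M) : FreeInverseMonoid X →* M :=
  (conGen (VagnerRel X)).lift (FreeMonoid.lift (letterVal ι)) <| Con.conGen_le.2 fun a b h => by
    have hval : ∀ w : InvWord X, FreeMonoid.lift (letterVal ι) (.ofList w) = wordVal ι w :=
      fun w => FreeMonoid.lift_apply _ _
    rw [Con.ker_rel]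
    rcases h with w | ⟨w, z⟩ <;> simp only [hval, wordVal_append, wordVal_invRev]
    · exact mul_inv_mul' _
    · exact comm_rr _ _

theorem lift_mk (ι : X → M) (w : InvWord X) : lift ι (mk w) = wordVal ι w :=
  FreeMonoid.lift_apply _ _

theorem lift_of (ι : X → M) (x : X) : lift ι (of x) = ι x :=
  (lift_mk ι _).trans (wordVal_singleton ι (x, true))

theorem hom_ext {f g : FreeInverseMonoid X →* M} (h : ∀ x, f (of x) = g (of x)) : f = g := by
  refine MonoidHom.ext (ind fun w => ?_)
  rw [← wordVal_of, map_wordVal of f (InverseMonoid.map_inv f),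
    map_wordVal of g (InverseMonoid.map_inv g), show f ∘ of = g ∘ of from funext h]

variable (X) in
/-- Munn's representation of the free inverse monoid by finite connected subgraphs of the Cayley
graph of the free group with a distinguished vertex. -/
def munnEquiv : FreeInverseMonoid X ≃* ClosureMonoid (redClosure X) :=
  MulEquiv.ofBijective (lift (ClosureMonoid.of (redClosure X))) <| by
    refine ⟨ind fun w => ind fun z => fun h => ?_, fun s => ?_⟩
    · rw [lift_mk, lift_mk] at h
      have hgraph := congrArg ClosureMonoid.graph h
      have helt := congrArg ClosureMonoid.elt h
      rw [ClosureMonoid.graph_wordVal_of_redClosure,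
        ClosureMonoid.graph_wordVal_of_redClosure] at hgraph
      rw [ClosureMonoid.elt_wordVal_of, ClosureMonoid.elt_wordVal_of, wordVal_freeGroup,
        wordVal_freeGroup] at helt
      rw [← wordVal_of, ← wordVal_of]
      exact (wordVal_natLE_of_pathSpan_le of helt hgraph.ge).antisymm
        (wordVal_natLE_of_pathSpan_le of helt.symm hgraph.le)
    · obtain ⟨w, rfl⟩ := s.exists_wordVal_of_eq
      exact ⟨mk w, lift_mk _ w⟩

theorem munnEquiv_of (x : X) : munnEquiv X (of x) = ClosureMonoid.of (redClosure X) x :=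
  lift_of (ClosureMonoid.of (redClosure X)) x

theorem munnEquiv_wordVal (w : InvWord X) :
    munnEquiv X (wordVal of w) = wordVal (ClosureMonoid.of (redClosure X)) w := by
  rw [wordVal_of]
  exact lift_mk _ w

theorem isSigmaGreatest_red (w : InvWord X) :
    IsSigmaGreatest (wordVal of w) (wordVal (of : X → FreeInverseMonoid X) (red w)) := by
  have hle := wordVal_natLE_wordVal_red (of : X → FreeInverseMonoid X) w
  refine ⟨⟨_, NatLE.refl _, hle⟩, ind fun z h => ?_⟩
  have hmk : FreeGroup.mk w = FreeGroup.mk z := by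
    have helt := ClosureMonoid.sigma_iff_elt_eq.1 (h.map (munnEquiv X))
    rwa [← wordVal_of, munnEquiv_wordVal, munnEquiv_wordVal, ClosureMonoid.elt_wordVal_of,
      ClosureMonoid.elt_wordVal_of, wordVal_freeGroup, wordVal_freeGroup] at helt
  rw [← wordVal_of, red_eq_red_iff.2 hmk]
  exact wordVal_natLE_wordVal_red of z

instance : FInverseMonoid (FreeInverseMonoid X) where
  maxi s := (munnEquiv X).symm (maxi (munnEquiv X s))
  isSigmaGreatest_maxi s := by
    simpa using (isSigmaGreatest_maxi (munnEquiv X s)).map_equiv (munnEquiv X).symm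

theorem maxi_wordVal (w : InvWord X) :
    maxi (wordVal of w) = wordVal (of : X → FreeInverseMonoid X) (red w) :=
  (isSigmaGreatest_maxi _).unique (isSigmaGreatest_red w)

end FreeInverseMonoid

/-! ## Presented F-inverse monoids -/

namespace FQuotient

variable {M N : Type*} [FInverseMonoid M] [FInverseMonoid N] {r : M → M → Prop}

variable (r) in
/-- The projection onto the quotient, as a homomorphism. -/
def mkHom : M →* FQuotient r where
  toFun := mk r
  map_one' := rfl
  map_mul' _ _ := rfl

theorem map_eq_of_fCongGen (f : M →* N) (hm : ∀ s, f (maxi s) = maxi (f s))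
    (hr : ∀ a b, r a b → f a = f b) {a b : M} (h : FCongGen r a b) : f a = f b := by
  induction h with
  | of h => exact hr _ _ h
  | refl _ => rfl
  | symm _ ih => exact ih.symm
  | trans _ _ ih ih' => exact ih.trans ih'
  | mul _ _ ih ih' => rw [map_mul, map_mul, ih, ih']
  | inv _ ih => rw [InverseMonoid.map_inv, InverseMonoid.map_inv, ih]
  | maxi _ ih => rw [hm, hm, ih]

/-- The homomorphism induced on the quotient by a homomorphism of F-inverse monoids that respects
the relation. -/
def lift (f : M →* N) (hm : ∀ s, f (maxi s) = maxi (f s)) (hr : ∀ a b, r a b → f a = f b) :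
    FQuotient r →* N where
  toFun := Quotient.lift f fun _ _ => map_eq_of_fCongGen f hm hr
  map_one' := map_one f
  map_mul' := by rintro ⟨a⟩ ⟨b⟩; exact map_mul f a b

end FQuotient

namespace FInvPres

variable {X N : Type*} [FInverseMonoid N] {R : ImTerm X → ImTerm X → Prop}

theorem mk_val (p : ImTerm X) :
    FQuotient.mkHom (termRel R) (p.val maxi FreeFInverseMonoid.of) = p.val maxi (of R) :=
  ImTerm.map_val FreeFInverseMonoid.of (FQuotient.mkHom (termRel R)) (fun _ => rfl)
    (fun _ => rfl) p

theorem val_eq_val_of_rel {p q : ImTerm X} (h : R p q) : p.val maxi (of R) = q.val maxi (of R) := by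
  rw [← mk_val, ← mk_val]
  exact Quotient.sound (FCongGen.of ⟨p, q, h, rfl, rfl⟩)

theorem existsUnique_lift (ι : X → N) (hR : ∀ p q, R p q → p.val maxi ι = q.val maxi ι) :
    ∃! φ : FInvPres R →* N, (∀ s, φ (maxi s) = maxi (φ s)) ∧ ∀ x, φ (of R x) = ι x := by
  obtain ⟨f, ⟨hinv, hmax, hf⟩, huniq⟩ := FreeFInverseMonoid.existsUnique_lift ι
  have hval (p : ImTerm X) : f (p.val maxi FreeFInverseMonoid.of) = p.val maxi ι := by
    rw [ImTerm.map_val _ f hinv hmax, show f ∘ FreeFInverseMonoid.of = ι from funext hf]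
  have hrel : ∀ a b, termRel R a b → f a = f b := by
    rintro _ _ ⟨p, q, h, rfl, rfl⟩
    rw [hval, hval, hR p q h]
  refine ⟨FQuotient.lift f hmax hrel, ⟨?_, hf⟩, ?_⟩
  · rintro ⟨s⟩
    exact hmax s
  · rintro ψ ⟨hψmax, hψ⟩
    have hcomp : ψ.comp (FQuotient.mkHom (termRel R)) = f :=
      huniq _ ⟨InverseMonoid.map_inv _, fun s => hψmax (FQuotient.mk _ s), hψ⟩
    refine MonoidHom.ext ?_
    rintro ⟨s⟩
    exact DFunLike.congr_fun hcomp s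

theorem wordVal_red_eq_maxi (w : InvWord X) :
    wordVal (of (redRel X)) (red w) = maxi (wordVal (of (redRel X)) w) := by
  simpa only [ImTerm.val_ofWord, ImTerm.val_maxWord] using
    val_eq_val_of_rel (R := redRel X) ⟨w, rfl, rfl⟩

theorem exists_redRel_equiv_freeInverseMonoid (X : Type*) :
    ∃ φ : FInvPres (redRel X) ≃* FreeInverseMonoid X,
      ∀ x, φ (of (redRel X) x) = FreeInverseMonoid.of x := by
  obtain ⟨f, ⟨hfmax, hf⟩, -⟩ := existsUnique_lift (R := redRel X) FreeInverseMonoid.of (by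
    rintro _ _ ⟨w, rfl, rfl⟩
    rw [ImTerm.val_ofWord, ImTerm.val_maxWord, FreeInverseMonoid.maxi_wordVal])
  let g := FreeInverseMonoid.lift (of (redRel X))
  have hg : ∀ x, g (FreeInverseMonoid.of x) = of (redRel X) x := FreeInverseMonoid.lift_of _
  have hgmax : ∀ s, g (maxi s) = maxi (g s) := FreeInverseMonoid.ind fun w => by
    rw [← FreeInverseMonoid.wordVal_of, FreeInverseMonoid.maxi_wordVal,
      FreeInverseMonoid.wordVal_of, FreeInverseMonoid.wordVal_of, FreeInverseMonoid.lift_mk,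
      FreeInverseMonoid.lift_mk, wordVal_red_eq_maxi]
  have hfg : f.comp g = MonoidHom.id _ := FreeInverseMonoid.hom_ext fun x => by
    rw [MonoidHom.comp_apply, hg, hf, MonoidHom.id_apply]
  have hgf : g.comp f = MonoidHom.id _ :=
    (existsUnique_lift (of (redRel X)) fun _ _ => val_eq_val_of_rel).unique
      ⟨fun s => by simp only [MonoidHom.comp_apply, hfmax, hgmax],
        fun x => by rw [MonoidHom.comp_apply, hf, hg]⟩ ⟨fun _ => rfl, fun _ => rfl⟩
  exact ⟨f.toMulEquiv g hgf hfg, hf⟩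

end FInvPres

end

theorem mainTheorem7 (X : Type*) :
    -- the free inverse monoid is F-inverse, the greatest element above `w` being `red w`
    (∀ s : FreeInverseMonoid X, ∃ m, InverseMonoid.IsSigmaGreatest s m) ∧
    (∀ w : InvWord X, InverseMonoid.IsSigmaGreatest (wordVal FreeInverseMonoid.of w)
      (wordVal FreeInverseMonoid.of (red w))) ∧
    -- canonical isomorphism of F-inverse monoids between the presented monoid and `FIM(X)`
    (∃ φ : FInvPres (redRel X) ≃* FreeInverseMonoid X,
      (∀ x, φ (FInvPres.of (redRel X) x) = FreeInverseMonoid.of x) ∧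
      (∀ s, φ s⁻¹ = (φ s)⁻¹) ∧
      (∀ s, InverseMonoid.IsSigmaGreatest (φ s) (φ (FInverseMonoid.maxi s)))) ∧
    -- the greatest group image of the presented monoid is the free group
    (∃ f : InverseMonoid.GroupImage (FInvPres (redRel X)) ≃* FreeGroup X,
      ∀ x, f (InverseMonoid.sigmaMk (FInvPres.of (redRel X) x)) = FreeGroup.of x) ∧
    -- closed subgraphs are exactly the connected subgraphs
    (∀ Δ : CayleySubgraph (FreeGroup.of : X → FreeGroup X),
      (redClosure X).op.IsClosed Δ ↔ Δ.Connected) ∧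
    -- the monoid of the closure operator is Munn's model
    (∀ (Δ : CayleySubgraph (FreeGroup.of : X → FreeGroup X)) (g : FreeGroup X),
      (∃ s : ClosureMonoid (redClosure X), s.graph = Δ ∧ s.elt = g) ↔
        Δ.IsFinite ∧ Δ.Connected ∧ 1 ∈ Δ.verts ∧ g ∈ Δ.verts) ∧
    (∀ s t : ClosureMonoid (redClosure X),
      (s * t).graph = s.graph ⊔ s.elt • t.graph ∧ (s * t).elt = s.elt * t.elt) ∧
    (∃ ψ : FreeInverseMonoid X ≃* ClosureMonoid (redClosure X),
      (∀ s, ψ s⁻¹ = (ψ s)⁻¹) ∧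
      (∀ w : InvWord X,
        (ψ (wordVal FreeInverseMonoid.of w)).graph =
          CayleySubgraph.pathSpan FreeGroup.of 1 w ∧
        (ψ (wordVal FreeInverseMonoid.of w)).elt = FreeGroup.mk w)) ∧
    (∃ θ : FInvPres (redRel X) ≃* ClosureMonoid (redClosure X),
      (∀ x, (θ (FInvPres.of (redRel X) x)).graph =
          (redClosure X).op (CayleySubgraph.edge FreeGroup.of 1 (x, true)) ∧
        (θ (FInvPres.of (redRel X) x)).elt = FreeGroup.of x) ∧
      (∀ s, θ s⁻¹ = (θ s)⁻¹) ∧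
      (∀ s, θ (FInverseMonoid.maxi s) = (θ s).maxi)) := by
  obtain ⟨φ, hφ⟩ := FInvPres.exists_redRel_equiv_freeInverseMonoid X
  let ψ := FreeInverseMonoid.munnEquiv X
  let θ := φ.trans ψ
  let f := (ClosureMonoid.eltHom (redClosure X)).comp θ.toMonoidHom
  have hθ (x : X) : θ (FInvPres.of (redRel X) x) = ClosureMonoid.of (redClosure X) x :=
    (congrArg ψ (hφ x)).trans (FreeInverseMonoid.munnEquiv_of x)
  have hf : Function.Surjective f := ClosureMonoid.eltHom_surjective.comp θ.surjective
  have hσ (s t : FInvPres (redRel X)) (h : f s = f t) : InverseMonoid.Sigma s t :=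
    (InverseMonoid.sigma_map_equiv_iff θ).1 (ClosureMonoid.sigma_iff_elt_eq.2 h)
  refine ⟨fun s => ⟨_, FInverseMonoid.isSigmaGreatest_maxi s⟩,
    FreeInverseMonoid.isSigmaGreatest_red, ⟨φ, hφ, InverseMonoid.map_inv φ, fun s => ?_⟩,
    ⟨InverseMonoid.groupImageEquiv f hf hσ, fun x => ?_⟩, fun _ => redClosure_isClosed_iff,
    fun _ _ => ClosureMonoid.exists_graph_eq_elt_eq_iff,
    fun s t => ⟨ClosureMonoid.graph_mul_redClosure s t, rfl⟩,
    ⟨ψ, InverseMonoid.map_inv ψ, fun w => ?_⟩,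
    ⟨θ, fun x => by rw [hθ]; exact ⟨rfl, rfl⟩, InverseMonoid.map_inv θ,
      FInverseMonoid.map_maxi θ⟩⟩
  · exact (FInverseMonoid.isSigmaGreatest_maxi s).map_equiv φ
  · exact (InverseMonoid.groupImageEquiv_sigmaMk f hf hσ _).trans
      (congrArg ClosureMonoid.elt (hθ x))
  · rw [FreeInverseMonoid.munnEquiv_wordVal, ClosureMonoid.graph_wordVal_of_redClosure,
      ClosureMonoid.elt_wordVal_of, wordVal_freeGroup]
    exact ⟨rfl, rfl⟩
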